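/- All formulas are quantifier-free, over a many-sorted signature with equality and countably many variables of each sort; domains of structures are non-empty; a theory is a class of structures, and an interpretation is a structure with values for the variables. A datatypes signature $\Sigma$ is a finite signature whose sorts are the disjoint union of $\mathbf{Elem}_\Sigma$ and $\mathbf{Struct}_\Sigma$, whose function symbols are constructors $c:\sigma_1\times\dots\times\sigma_n\to\sigma$ with $\sigma\in\mathbf{Struct}_\Sigma$ and, for each such $c$ and each $1\le i\le n$, a selector $s_{c,i}:\sigma\to\sigma_i$, and whose predicate symbols are a tester $is_c:\sigma$ for each constructor $c$. For a family $D$ of sets indexed by $\mathbf{Elem}_\Sigma$ let $T_\sigma(D)$ be the set of constructor trees of sort $\sigma$ over $D$ (with $T_\sigma(D)=D_\sigma$ for $\sigma\in\mathbf{Elem}_\Sigma$). It is required that $T_\sigma(\mathbf 1)\ne\emptyset$ for all $\sigma\in\mathbf{Struct}_\Sigma$, where $\mathbf 1$ consists of one-element sets. A sort $\sigma\in\mathbf{Struct}_\Sigma$ is inductive if $T_\sigma(\mathbf 1)$ is infinite. The theory ${\cal T}_\Sigma$ consists of the structures which, for some family $D$ of non-empty sets, have domains $T_\sigma(D)$,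 interpret constructors as tree constructors, satisfy $s_{c,i}(c(t_1,\dots,t_n))=t_i$ (with $s_{c,i}$ arbitrary on trees not built by $c$), and interpret $is_c$ as the set of trees built by $c$. Let $T$ be a theory and $S$ a set of sorts. $T$ is smooth w.r.t. $S$ if, for every formula $\phi$, every $T$-interpretation ${\cal A}\models\phi$ and all cardinals $\kappa(\sigma)\ge|\sigma^{\cal A}|$ $(\sigma\in S)$, some $T$-interpretation ${\cal A}'\models\phi$ has $|\sigma^{{\cal A}'}|=\kappa(\sigma)$ for all $\sigma\in S$. A formula $\phi$ is finitely witnessed if it is $T$-unsatisfiable or some $T$-interpretation ${\cal A}\models\phi$ satisfies $\sigma^{\cal A}=\{x^{\cal A}\mid x\text{ a variable of sort }\sigma\text{ in }\phi\}$ for all $\sigma\in S$; it is strongly finitely witnessed if $\phi\wedge\delta$ is finitely witnessed for every arrangement $\delta$ of every finite set $V$ of variables with sorts in $S$, where an arrangement of $V$ is the conjunction of all $x=y$ for pairs related by, and all $x\neq y$ for same-sorted pairs not related by, some sort-respecting equivalence relation on $V$. A (strong) witness for $T$ w.r.t. $S$ is a function $\mathit{wtn}$ on formulas such that, for every $\phi$,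 the formulas $\phi$ and $\exists\vec w.\,\mathit{wtn}(\phi)$ are $T$-equivalent, where $\vec w$ are the variables of $\mathit{wtn}(\phi)$ not in $\phi$, and $\mathit{wtn}(\phi)$ is (strongly) finitely witnessed. It is $S$-additive if, for every $\phi$ and every conjunction $\varphi$ of flat literals whose only terms are variables with sorts in $S$, the formulas $\mathit{wtn}(\mathit{wtn}(\phi)\wedge\varphi)$ and $\mathit{wtn}(\phi)\wedge\varphi$ are $T$-equivalent and have the same variables with sorts in $S$. $T$ is strongly polite w.r.t. $S$ if it is smooth w.r.t. $S$ and has a computable strong witness w.r.t. $S$; it is additively polite w.r.t. $S$ if it is smooth w.r.t. $S$ and has a computable $S$-additive witness w.r.t. $S$. **Theorem.** If $\Sigma$ is a datatypes signature and all sorts in $\mathbf{Struct}_\Sigma$ are inductive, then ${\cal T}_\Sigma$ is strongly polite w.r.t. $\mathbf{Elem}_\Sigma$; moreover, it is additively polite w.r.t. $\mathbf{Elem}_\Sigma$. -/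

import Mathlib

universe u

namespace Polite

/-! ## Many-sorted signatures, quantifier-free formulas, structures -/

/-- A many-sorted signature. A function symbol `f` has arity
`argF f 0 × ... × argF f (arF f - 1) → res f`, a predicate symbol `P` has arity
`argP P 0 × ... × argP P (arP P - 1)`. Equality is not listed among the predicate symbols:
it is a logical symbol, available at every sort. -/
structure Signature where
  Srt : Type
  Func : Type
  Pred : Type
  arF : Func → ℕ
  argF : (f : Func) → Fin (arF f) → Srt
  res : Func → Srt
  arP : Pred → ℕ
  argP : (P : Pred) → Fin (arP P) → Srt

/-- A signature is finite if it has finitely many sorts, function and predicate symbols. -/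
class Signature.IsFinite (Sg : Signature) : Prop where
  srt : Finite Sg.Srt
  func : Finite Sg.Func
  pred : Finite Sg.Pred

/-- Variables: countably many of every sort. -/
abbrev Var (Sg : Signature) : Type := (_ : Sg.Srt) × ℕ

/-- Terms, indexed by their sort. -/
inductive Term (Sg : Signature) : Sg.Srt → Type
  | var (s : Sg.Srt) (n : ℕ) : Term Sg s
  | app (f : Sg.Func) (args : (i : Fin (Sg.arF f)) → Term Sg (Sg.argF f i)) : Term Sg (Sg.res f)

/-- Quantifier-free formulas. -/
inductive QF (Sg : Signature) : Type
  | eq {s : Sg.Srt} (t t' : Term Sg s) : QF Sg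
  | pred (P : Sg.Pred) (args : (i : Fin (Sg.arP P)) → Term Sg (Sg.argP P i)) : QF Sg
  | tru : QF Sg
  | fls : QF Sg
  | neg (φ : QF Sg) : QF Sg
  | and (φ ψ : QF Sg) : QF Sg
  | or (φ ψ : QF Sg) : QF Sg

/-- The variables of a term. -/
def Term.fv {Sg : Signature} : {s : Sg.Srt} → Term Sg s → Set (Var Sg)
  | _, .var s n => {⟨s, n⟩}
  | _, .app _ args => {x | ∃ i, x ∈ (args i).fv}

/-- The (free) variables of a quantifier-free formula. -/
def QF.fv {Sg : Signature} : QF Sg → Set (Var Sg)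
  | .eq t t' => t.fv ∪ t'.fv
  | .pred _ args => {x | ∃ i, x ∈ (args i).fv}
  | .tru => ∅
  | .fls => ∅
  | .neg φ => φ.fv
  | .and φ ψ => φ.fv ∪ ψ.fv
  | .or φ ψ => φ.fv ∪ ψ.fv

/-- Interpretations of the function and predicate symbols over a family of domains. -/
structure Ops (Sg : Signature) (M : Sg.Srt → Type u) where
  func : (f : Sg.Func) → ((i : Fin (Sg.arF f)) → M (Sg.argF f i)) → M (Sg.res f)
  pred : (P : Sg.Pred) → ((i : Fin (Sg.arP P)) → M (Sg.argP P i)) → Prop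

/-- A structure: a non-empty domain for every sort, and interpretations of the symbols. -/
structure Structure (Sg : Signature) where
  dom : Sg.Srt → Type u
  nonempty : ∀ s, Nonempty (dom s)
  ops : Ops Sg dom

/-- An interpretation: a structure together with values of the variables. -/
structure Interpretation (Sg : Signature) extends Structure.{u} Sg where
  val : (s : Sg.Srt) → ℕ → dom s

/-- The value of a term. -/
def Term.eval {Sg : Signature} {M : Sg.Srt → Type u} (O : Ops Sg M) (v : (s : Sg.Srt) → ℕ → M s) :
    {s : Sg.Srt} → Term Sg s → M s
  | _, .var s n => v s n
  | _, .app f args => O.func f (fun i => (args i).eval O v)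

/-- Truth of a quantifier-free formula; equality is interpreted as identity. -/
def QF.holds {Sg : Signature} {M : Sg.Srt → Type u} (O : Ops Sg M) (v : (s : Sg.Srt) → ℕ → M s) :
    QF Sg → Prop
  | .eq t t' => t.eval O v = t'.eval O v
  | .pred P args => O.pred P (fun i => (args i).eval O v)
  | .tru => True
  | .fls => False
  | .neg φ => ¬ φ.holds O v
  | .and φ ψ => φ.holds O v ∧ ψ.holds O v
  | .or φ ψ => φ.holds O v ∨ ψ.holds O v

/-- `I.Sat φ`: the interpretation `I` satisfies `φ`. -/
def Interpretation.Sat {Sg : Signature} (I : Interpretation.{u} Sg) (φ : QF Sg) : Prop :=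
  φ.holds I.ops I.val

/-- A theory is a class of structures. -/
abbrev Theory (Sg : Signature) := Set (Structure.{u} Sg)

/-- `I` is a `T`-interpretation: its variable-free part is in `T`. -/
def Interpretation.IsModel {Sg : Signature} (I : Interpretation.{u} Sg) (T : Theory.{u} Sg) : Prop :=
  I.toStructure ∈ T

/-- `T`-satisfiability. -/
def Satisfiable {Sg : Signature} (T : Theory.{u} Sg) (φ : QF Sg) : Prop :=
  ∃ I : Interpretation.{u} Sg, I.IsModel T ∧ I.Sat φ

/-- `T`-equivalence of quantifier-free formulas. -/
def TEquiv {Sg : Signature} (T : Theory.{u} Sg) (φ ψ : QF Sg) : Prop :=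
  ∀ I : Interpretation.{u} Sg, I.IsModel T → (I.Sat φ ↔ I.Sat ψ)

/-- `I.SatEx W ψ`: the interpretation `I` satisfies `∃ W. ψ`, i.e. `ψ` becomes true after a
change of the values of the variables in `W`. -/
def Interpretation.SatEx {Sg : Signature} (I : Interpretation.{u} Sg) (W : Set (Var Sg))
    (ψ : QF Sg) : Prop :=
  ∃ v : (s : Sg.Srt) → ℕ → I.dom s,
    (∀ s n, (⟨s, n⟩ : Var Sg) ∉ W → v s n = I.val s n) ∧ ψ.holds I.ops v

/-! ## Conjunctions, flat literals, arrangements -/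

/-- The conjuncts of a formula, whatever the bracketing; `tru` is the empty conjunction. -/
def QF.conjuncts {Sg : Signature} : QF Sg → Set (QF Sg)
  | .and φ ψ => φ.conjuncts ∪ ψ.conjuncts
  | .tru => ∅
  | φ => {φ}

/-- Flat literals: `x = y`, `x ≠ y`, `x = f(x₁, ..., xₙ)`, `P(x₁, ..., xₙ)`, `¬ P(x₁, ..., xₙ)`. -/
inductive IsFlatLiteral {Sg : Signature} : QF Sg → Prop
  | eqVar (s : Sg.Srt) (x y : ℕ) : IsFlatLiteral (.eq (.var s x) (.var s y))
  | neVar (s : Sg.Srt) (x y : ℕ) : IsFlatLiteral (.neg (.eq (.var s x) (.var s y)))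
  | eqApp (f : Sg.Func) (x : ℕ) (xs : Fin (Sg.arF f) → ℕ) :
      IsFlatLiteral (.eq (.var (Sg.res f) x) (.app f (fun i => .var (Sg.argF f i) (xs i))))
  | pred (P : Sg.Pred) (xs : Fin (Sg.arP P) → ℕ) :
      IsFlatLiteral (.pred P (fun i => .var (Sg.argP P i) (xs i)))
  | negPred (P : Sg.Pred) (xs : Fin (Sg.arP P) → ℕ) :
      IsFlatLiteral (.neg (.pred P (fun i => .var (Sg.argP P i) (xs i))))

/-- The formula is a conjunction of flat literals. -/
def IsFlatConj {Sg : Signature} (φ : QF Sg) : Prop :=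
  ∀ ψ ∈ φ.conjuncts, IsFlatLiteral ψ

/-- The term is a variable whose sort is in `S`. -/
def Term.IsVarIn {Sg : Signature} (S : Set Sg.Srt) {s : Sg.Srt} (t : Term Sg s) : Prop :=
  s ∈ S ∧ ∃ n, t = .var s n

/-- Every term in the formula is a variable whose sort is in `S`. -/
def QF.TermsAreVarsIn {Sg : Signature} (S : Set Sg.Srt) : QF Sg → Prop
  | .eq t t' => t.IsVarIn S ∧ t'.IsVarIn S
  | .pred _ args => ∀ i, (args i).IsVarIn S
  | .tru => True
  | .fls => True
  | .neg φ => φ.TermsAreVarsIn S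
  | .and φ ψ => φ.TermsAreVarsIn S ∧ ψ.TermsAreVarsIn S
  | .or φ ψ => φ.TermsAreVarsIn S ∧ ψ.TermsAreVarsIn S

/-- `δ` is an arrangement of the finite set `V` of variables: for some equivalence relation `E s` on
the variables of sort `s` in `V` (for every sort `s`), `δ` is a conjunction of the literals `x = y`
for the related pairs and `x ≠ y` for the unrelated pairs. -/
def IsArrangement {Sg : Signature} (V : Finset (Var Sg)) (δ : QF Sg) : Prop :=
  ∃ E : (s : Sg.Srt) → Setoid {n : ℕ // (⟨s, n⟩ : Var Sg) ∈ V},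
    δ.conjuncts =
      {ψ | ∃ s, ∃ x y : {n : ℕ // (⟨s, n⟩ : Var Sg) ∈ V},
        ((E s).r x y ∧ ψ = .eq (.var s x.1) (.var s y.1)) ∨
        (¬ (E s).r x y ∧ ψ = .neg (.eq (.var s x.1) (.var s y.1)))}

/-! ## Computable functions on formulas -/

/-- A numbering of a finite type. -/
noncomputable def num {α : Type} (h : Finite α) (a : α) : ℕ := (@Finite.equivFin α h a).1

/-- Gödel numbers of terms over a finite signature. -/
noncomputable def Term.code {Sg : Signature} [h : Sg.IsFinite] : {s : Sg.Srt} → Term Sg s → ℕ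
  | _, .var s n => Nat.pair 0 (Nat.pair (num h.srt s) n)
  | _, .app f args =>
      Nat.pair 1 (Nat.pair (num h.func f) (Encodable.encode (List.ofFn fun i => (args i).code)))

/-- Gödel numbers of quantifier-free formulas over a finite signature. -/
noncomputable def QF.code {Sg : Signature} [h : Sg.IsFinite] : QF Sg → ℕ
  | .eq (s := s) t t' => Nat.pair 0 (Nat.pair (num h.srt s) (Nat.pair t.code t'.code))
  | .pred P args =>
      Nat.pair 1 (Nat.pair (num h.pred P) (Encodable.encode (List.ofFn fun i => (args i).code)))
  | .tru => Nat.pair 2 0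
  | .fls => Nat.pair 3 0
  | .neg φ => Nat.pair 4 φ.code
  | .and φ ψ => Nat.pair 5 (Nat.pair φ.code ψ.code)
  | .or φ ψ => Nat.pair 6 (Nat.pair φ.code ψ.code)

/-- A function on quantifier-free formulas is computable if it is computed, on Gödel numbers, by a
partial recursive function. (The choice of the numbering of the finitely many symbols is
immaterial.) -/
def IsComputable {Sg : Signature} [Sg.IsFinite] (f : QF Sg → QF Sg) : Prop :=
  ∃ F : ℕ →. ℕ, Nat.Partrec F ∧ ∀ φ, (f φ).code ∈ F φ.code

/-! ## Politeness -/

/-- `T` is smooth w.r.t. `S`. -/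
def Smooth {Sg : Signature} (T : Theory.{u} Sg) (S : Set Sg.Srt) : Prop :=
  ∀ (φ : QF Sg) (I : Interpretation.{u} Sg), I.IsModel T → I.Sat φ →
    ∀ κ : S → Cardinal.{u}, (∀ s : S, Cardinal.mk (I.dom s) ≤ κ s) →
      ∃ J : Interpretation.{u} Sg, J.IsModel T ∧ J.Sat φ ∧ ∀ s : S, Cardinal.mk (J.dom s) = κ s

/-- `I` finitely witnesses `φ` for `T` w.r.t. `S`. -/
def FinitelyWitnesses {Sg : Signature} (T : Theory.{u} Sg) (S : Set Sg.Srt)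
    (I : Interpretation.{u} Sg) (φ : QF Sg) : Prop :=
  I.IsModel T ∧ I.Sat φ ∧
    ∀ s ∈ S, ∀ a : I.dom s, ∃ n, (⟨s, n⟩ : Var Sg) ∈ φ.fv ∧ I.val s n = a

/-- `φ` is finitely witnessed for `T` w.r.t. `S`. -/
def FinitelyWitnessed {Sg : Signature} (T : Theory.{u} Sg) (S : Set Sg.Srt) (φ : QF Sg) : Prop :=
  ¬ Satisfiable T φ ∨ ∃ I : Interpretation.{u} Sg, FinitelyWitnesses T S I φ

/-- `φ` is strongly finitely witnessed for `T` w.r.t. `S`. -/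
def StronglyFinitelyWitnessed {Sg : Signature} (T : Theory.{u} Sg) (S : Set Sg.Srt)
    (φ : QF Sg) : Prop :=
  ∀ V : Finset (Var Sg), (∀ x ∈ V, x.1 ∈ S) →
    ∀ δ : QF Sg, IsArrangement V δ → FinitelyWitnessed T S (.and φ δ)

/-- `φ` and `∃ w. wtn φ` are `T`-equivalent, where `w` are the variables of `wtn φ` that do not
occur in `φ`. -/
def ExEquivalent {Sg : Signature} (T : Theory.{u} Sg) (wtn : QF Sg → QF Sg) : Prop :=
  ∀ (φ : QF Sg) (I : Interpretation.{u} Sg), I.IsModel T →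
    (I.Sat φ ↔ I.SatEx ((wtn φ).fv \ φ.fv) (wtn φ))

/-- `wtn` is a witness for `T` w.r.t. `S`. -/
def IsWitness {Sg : Signature} (T : Theory.{u} Sg) (S : Set Sg.Srt) (wtn : QF Sg → QF Sg) : Prop :=
  ExEquivalent T wtn ∧ ∀ φ, FinitelyWitnessed T S (wtn φ)

/-- `wtn` is a strong witness for `T` w.r.t. `S`. -/
def IsStrongWitness {Sg : Signature} (T : Theory.{u} Sg) (S : Set Sg.Srt)
    (wtn : QF Sg → QF Sg) : Prop :=
  ExEquivalent T wtn ∧ ∀ φ, StronglyFinitelyWitnessed T S (wtn φ)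

/-- `f` is `S`-additive for `T`. -/
def IsAdditive {Sg : Signature} (T : Theory.{u} Sg) (S : Set Sg.Srt) (f : QF Sg → QF Sg) : Prop :=
  ∀ φ ψ : QF Sg, IsFlatConj ψ → ψ.TermsAreVarsIn S →
    TEquiv T (f (.and (f φ) ψ)) (.and (f φ) ψ) ∧
    ∀ s ∈ S, ∀ n, (⟨s, n⟩ : Var Sg) ∈ (f (.and (f φ) ψ)).fv ↔ (⟨s, n⟩ : Var Sg) ∈ (QF.and (f φ) ψ).fv

/-- `T` is strongly polite w.r.t. `S`: smooth and strongly finitely witnessable. -/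
def StronglyPolite {Sg : Signature} [Sg.IsFinite] (T : Theory.{u} Sg) (S : Set Sg.Srt) : Prop :=
  Smooth T S ∧ ∃ wtn : QF Sg → QF Sg, IsComputable wtn ∧ IsStrongWitness T S wtn

/-- `T` is additively polite w.r.t. `S`: smooth and additively finitely witnessable. -/
def AdditivelyPolite {Sg : Signature} [Sg.IsFinite] (T : Theory.{u} Sg) (S : Set Sg.Srt) : Prop :=
  Smooth T S ∧ ∃ wtn : QF Sg → QF Sg, IsComputable wtn ∧ IsWitness T S wtn ∧ IsAdditive T S wtn

/-! ## Datatypes -/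

/-- The data of a datatypes signature: element sorts, struct sorts and constructors
`c : arg c 0 × ... × arg c (ar c - 1) → res c`, where `res c` is a struct sort. -/
structure DatatypesData where
  Elem : Type
  Struct : Type
  Con : Type
  ar : Con → ℕ
  arg : (c : Con) → Fin (ar c) → Elem ⊕ Struct
  res : Con → Struct

/-- The constructor trees over a family `D` of sets of elements, indexed by their sort. -/
inductive Tree (Dt : DatatypesData) (D : Dt.Elem → Type u) : Dt.Elem ⊕ Dt.Struct → Type u
  | leaf {e : Dt.Elem} (a : D e) : Tree Dt D (.inl e)
  | node (c : Dt.Con) (args : (i : Fin (Dt.ar c)) → Tree Dt D (Dt.arg c i)) :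
      Tree Dt D (.inr (Dt.res c))

/-- Datatypes signatures: finite, and well-founded in the sense that every struct sort has a
tree over the family of one-element sets. -/
structure DatatypesSignature extends DatatypesData where
  finite_elem : Finite Elem
  finite_struct : Finite Struct
  finite_con : Finite Con
  wellFounded : ∀ s : Struct, Nonempty (Tree toDatatypesData (fun _ => Unit) (.inr s))

/-- The function symbols: constructors `c` and selectors `s_{c,i}`. -/
inductive DatatypesData.FuncSym (Dt : DatatypesData) : Type
  | con (c : Dt.Con)
  | sel (c : Dt.Con) (i : Fin (Dt.ar c))

/-- The predicate symbols: testers `is_c`. -/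
inductive DatatypesData.PredSym (Dt : DatatypesData) : Type
  | is (c : Dt.Con)

/-- The many-sorted signature: `c : arg c 0 × ... → res c`, `s_{c,i} : res c → arg c i` and
`is_c : res c`. -/
abbrev DatatypesData.sig (Dt : DatatypesData) : Signature where
  Srt := Dt.Elem ⊕ Dt.Struct
  Func := Dt.FuncSym
  Pred := Dt.PredSym
  arF := fun f => match f with
    | .con c => Dt.ar c
    | .sel _ _ => 1
  argF := fun f => match f with
    | .con c => Dt.arg c
    | .sel c _ => fun _ => .inr (Dt.res c)
  res := fun f => match f with
    | .con c => .inr (Dt.res c)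
    | .sel c i => Dt.arg c i
  arP := fun _ => 1
  argP := fun P => match P with
    | .is c => fun _ => .inr (Dt.res c)

instance DatatypesSignature.sig_isFinite (Dt : DatatypesSignature) : Dt.sig.IsFinite where
  srt := by
    have := Dt.finite_elem
    have := Dt.finite_struct
    exact inferInstanceAs (Finite (Dt.Elem ⊕ Dt.Struct))
  func := by
    have := Dt.finite_con
    refine Finite.of_surjective
      (fun x : Dt.Con ⊕ ((c : Dt.Con) × Fin (Dt.ar c)) => match x with
        | .inl c => (DatatypesData.FuncSym.con c : Dt.FuncSym)
        | .inr p => .sel p.1 p.2) ?_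
    intro f
    cases f with
    | con c => exact ⟨.inl c, rfl⟩
    | sel c i => exact ⟨.inr ⟨c, i⟩, rfl⟩
  pred := by
    have := Dt.finite_con
    refine Finite.of_surjective (fun c : Dt.Con => (DatatypesData.PredSym.is c : Dt.PredSym)) ?_
    rintro ⟨c⟩
    exact ⟨c, rfl⟩

/-- The set of element sorts. -/
def DatatypesData.elemSorts (Dt : DatatypesData) : Set Dt.sig.Srt :=
  {s | ∃ e : Dt.Elem, s = Sum.inl e}

/-- A struct sort is inductive if it has infinitely many trees over the family of one-element
sets; otherwise it is finite. -/
def DatatypesData.IsInductiveSort (Dt : DatatypesData) (s : Dt.Struct) : Prop :=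
  Infinite (Tree Dt (fun _ => Unit) (.inr s))

/-- There are trees of every sort over a family of non-empty sets. -/
theorem DatatypesSignature.tree_nonempty (Dt : DatatypesSignature) (D : Dt.Elem → Type u)
    (hD : ∀ e, Nonempty (D e)) (s : Dt.sig.Srt) : Nonempty (Tree Dt.toDatatypesData D s) := by
  have key : ∀ (r : Dt.Elem ⊕ Dt.Struct), Tree Dt.toDatatypesData (fun _ => Unit) r →
      Nonempty (Tree Dt.toDatatypesData D r) := by
    intro r t
    induction t with
    | leaf a => exact (hD _).map Tree.leaf
    | node c args ih => exact ⟨Tree.node c (fun i => Classical.choice (ih i))⟩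
  rcases s with e | s
  · exact (hD e).map Tree.leaf
  · obtain ⟨t⟩ := Dt.wellFounded s
    exact key _ t

/-- The conditions on the interpretations of the symbols in a datatypes structure generated by `D`.
A selector `s_{c,i}` is unconstrained on trees that are not built by `c`. -/
structure IsDatatypesOps (Dt : DatatypesData) (D : Dt.Elem → Type u)
    (O : Ops Dt.sig (Tree Dt D)) : Prop where
  con : ∀ (c : Dt.Con) (args : (i : Fin (Dt.ar c)) → Tree Dt D (Dt.arg c i)),
    O.func (.con c) args = Tree.node c args
  sel : ∀ (c : Dt.Con) (args : (i : Fin (Dt.ar c)) → Tree Dt D (Dt.arg c i)) (i : Fin (Dt.ar c)),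
    O.func (.sel c i) (fun _ => Tree.node c args) = args i
  tester : ∀ (c : Dt.Con) (t : Tree Dt D (.inr (Dt.res c))),
    O.pred (.is c) (fun _ => t) ↔
      ∃ args : (i : Fin (Dt.ar c)) → Tree Dt D (Dt.arg c i), t = Tree.node c args

/-- The theory of datatypes: the class of datatypes structures. -/
def DatatypesSignature.theory (Dt : DatatypesSignature) : Theory.{u} Dt.sig :=
  {A | ∃ (D : Dt.Elem → Type u) (hD : ∀ e, Nonempty (D e))
      (O : Ops Dt.sig (Tree Dt.toDatatypesData D)),
      IsDatatypesOps Dt.toDatatypesData D O ∧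
      A = ⟨Tree Dt.toDatatypesData D, Dt.tree_nonempty D hD, O⟩}

end Polite

namespace Polite

/-! ### Generalities on formulas: coincidence lemmas, Gödel numbers, finite conjunctions and
disjunctions -/

section Formulas

variable {Sg : Signature}

/-! The witness of φ is φ together with guards. For each subterm t of struct sort, the guard is the
disjunction of t = c(y₁, ..., yₙ) over all constructors c, where yᵢ is a fresh variable named after
s_{c,i}(t); for each compound subterm of element sort it is an equation with a fresh variable; and x
= x is added for one variable of each element sort. The guards cost nothing: giving every fresh
variable the value of the term it names makes them true (`exEquivalent_witness`).

Conversely, take a model of the guards, and let V be the finite set of values of the variables. Call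
a node tame if its immediate subtrees lie in V, and a leaf tame if it lies in V. The guards force
every subterm to have a tame value. For a finite witness, keep only the elements that are values of
variables and apply `collapse`: tame nodes are kept and treated recursively, and every other node is
replaced by a tree over the remaining elements, chosen by an index. If B bounds the heights of tame
trees, the replacements are chosen so high and so far apart (more than B for different indices) that
building a tame tree on top of them cannot create a coincidence. So the collapse is injective on
tame trees (`collapse_injective`) and commutes with their constructors. Inductivity of the sorts
supplies trees of unbounded height. Selectors are free on trees with the wrong constructor, so they
can be copied along the collapse (`isTransfer_transferOps`), and formulas whose subterms have tame
values keep their truth value (`IsTransfer.holds`). An arrangement mentions only variables of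
element sorts, whose values are tame, so the witness is strong.

Smoothness uses the same transfer, with V the set of all trees and an injection of the elements.
Additivity is built in: on (χ ∧ `extension` χ) ∧ ψ only ψ is guarded, and a ψ over element variables
needs no guard. The witness is primitive recursive on Gödel numbers. -/

theorem Term.eval_congr {M : Sg.Srt → Type u} (O : Ops Sg M) {v w : (s : Sg.Srt) → ℕ → M s}
    {s : Sg.Srt} (t : Term Sg s) (h : ∀ s n, (⟨s, n⟩ : Var Sg) ∈ t.fv → v s n = w s n) :
    t.eval O v = t.eval O w := by
  induction t with
  | var s n => exact h s n rfl
  | app f args ih =>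
    simp only [Term.eval]
    congr 1
    funext i
    exact ih i fun s n hn => h s n ⟨i, hn⟩

theorem QF.holds_congr {M : Sg.Srt → Type u} (O : Ops Sg M) {v w : (s : Sg.Srt) → ℕ → M s}
    (φ : QF Sg) (h : ∀ s n, (⟨s, n⟩ : Var Sg) ∈ φ.fv → v s n = w s n) :
    φ.holds O v ↔ φ.holds O w := by
  induction φ with
  | eq t t' =>
    simp only [QF.holds]
    rw [t.eval_congr O fun s n hn => h s n (Or.inl hn),
      t'.eval_congr O fun s n hn => h s n (Or.inr hn)]
  | pred P args =>
    simp only [QF.holds]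
    have : (fun i => (args i).eval O v) = fun i => (args i).eval O w :=
      funext fun i => (args i).eval_congr O fun s n hn => h s n ⟨i, hn⟩
    rw [this]
  | tru => rfl
  | fls => rfl
  | neg φ ih => exact not_congr (ih h)
  | and φ ψ ih₁ ih₂ =>
    exact and_congr (ih₁ fun s n hn => h s n (Or.inl hn)) (ih₂ fun s n hn => h s n (Or.inr hn))
  | or φ ψ ih₁ ih₂ =>
    exact or_congr (ih₁ fun s n hn => h s n (Or.inl hn)) (ih₂ fun s n hn => h s n (Or.inr hn))

theorem Term.fv_finite {s : Sg.Srt} (t : Term Sg s) : t.fv.Finite := by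
  induction t with
  | var s n => exact Set.finite_singleton _
  | app f args ih =>
    refine (Set.finite_iUnion ih).subset ?_
    rintro x ⟨i, hi⟩
    exact Set.mem_iUnion.2 ⟨i, hi⟩

theorem QF.fv_finite (φ : QF Sg) : φ.fv.Finite := by
  induction φ with
  | eq t t' => exact t.fv_finite.union t'.fv_finite
  | pred P args =>
    refine (Set.finite_iUnion fun i => (args i).fv_finite).subset ?_
    rintro x ⟨i, hi⟩
    exact Set.mem_iUnion.2 ⟨i, hi⟩
  | tru => exact Set.finite_empty
  | fls => exact Set.finite_empty
  | neg φ ih => exact ih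
  | and φ ψ ih₁ ih₂ => exact ih₁.union ih₂
  | or φ ψ ih₁ ih₂ => exact ih₁.union ih₂

/-- Makes codes of arguments smaller than codes of applications, as course-of-values recursion on
codes requires. -/
theorem lt_encode_of_mem {l : List ℕ} {a : ℕ} (h : a ∈ l) : a < Encodable.encode l := by
  induction l with
  | nil => simp at h
  | cons x l ih =>
    rw [Encodable.encode_list_cons, Encodable.encode_nat, Nat.lt_succ_iff]
    rcases List.mem_cons.1 h with rfl | h
    · exact Nat.left_le_pair _ _
    · exact (ih h).le.trans (Nat.right_le_pair _ _)

theorem num_injective {α : Type} (h : Finite α) : Function.Injective (num h) := by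
  intro a b hab
  exact (@Finite.equivFin α h).injective (Fin.ext hab)

/-! ### Gödel numbers: bounds and injectivity -/

section Codes

variable [h : Sg.IsFinite]

theorem Term.code_arg_lt (f : Sg.Func) (args : (i : Fin (Sg.arF f)) → Term Sg (Sg.argF f i))
    (i : Fin (Sg.arF f)) : (args i).code < (Term.app f args).code := by
  rw [Term.code]
  refine (lt_encode_of_mem (l := List.ofFn fun i => (args i).code)
    (List.mem_ofFn.2 ⟨i, rfl⟩)).trans_le ?_
  exact (Nat.right_le_pair _ _).trans (Nat.right_le_pair _ _)

theorem QF.code_arg_lt (P : Sg.Pred) (args : (i : Fin (Sg.arP P)) → Term Sg (Sg.argP P i))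
    (i : Fin (Sg.arP P)) : (args i).code < (QF.pred P args).code := by
  rw [QF.code]
  refine (lt_encode_of_mem (l := List.ofFn fun i => (args i).code)
    (List.mem_ofFn.2 ⟨i, rfl⟩)).trans_le ?_
  exact (Nat.right_le_pair _ _).trans (Nat.right_le_pair _ _)

theorem lt_pair_of_pos {a : ℕ} (ha : 0 < a) (b : ℕ) : b < Nat.pair a b := by
  unfold Nat.pair
  split_ifs <;> nlinarith

theorem QF.code_left_lt (φ ψ : QF Sg) : φ.code < (QF.and φ ψ).code := by
  rw [QF.code.eq_def (QF.and φ ψ)]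
  exact (Nat.left_le_pair _ _).trans_lt (lt_pair_of_pos (by norm_num) _)

theorem Term.index_le_code {s : Sg.Srt} (t : Term Sg s) {x : Var Sg} (hx : x ∈ t.fv) :
    x.2 ≤ t.code := by
  induction t with
  | var s n =>
    rw [Term.fv, Set.mem_singleton_iff] at hx
    subst hx
    rw [Term.code]
    exact (Nat.right_le_pair _ _).trans (Nat.right_le_pair _ _)
  | app f args ih =>
    obtain ⟨i, hi⟩ := hx
    exact (ih i hi).trans (Term.code_arg_lt f args i).le

/-- Hence variables with index at least `φ.code + 1` are fresh for φ; this is the base used for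
names. -/
theorem QF.index_le_code (φ : QF Sg) {x : Var Sg} (hx : x ∈ φ.fv) : x.2 ≤ φ.code := by
  induction φ with
  | eq t t' =>
    rw [QF.code]
    rcases hx with hx | hx
    · exact (t.index_le_code hx).trans ((Nat.left_le_pair _ _).trans
        ((Nat.right_le_pair _ _).trans (Nat.right_le_pair _ _)))
    · exact (t'.index_le_code hx).trans ((Nat.right_le_pair _ _).trans
        ((Nat.right_le_pair _ _).trans (Nat.right_le_pair _ _)))
  | pred P args =>
    obtain ⟨i, hi⟩ := hx
    exact ((args i).index_le_code hi).trans (QF.code_arg_lt P args i).le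
  | tru => exact hx.elim
  | fls => exact hx.elim
  | neg φ ih => exact (ih hx).trans (by rw [QF.code]; exact Nat.right_le_pair _ _)
  | and φ ψ ih₁ ih₂ =>
    rw [QF.code]
    rcases hx with hx | hx
    · exact (ih₁ hx).trans ((Nat.left_le_pair _ _).trans (Nat.right_le_pair _ _))
    · exact (ih₂ hx).trans ((Nat.right_le_pair _ _).trans (Nat.right_le_pair _ _))
  | or φ ψ ih₁ ih₂ =>
    rw [QF.code]
    rcases hx with hx | hx
    · exact (ih₁ hx).trans ((Nat.left_le_pair _ _).trans (Nat.right_le_pair _ _))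
    · exact (ih₂ hx).trans ((Nat.right_le_pair _ _).trans (Nat.right_le_pair _ _))

/-- The two sorts are kept apart because the sort of an application is known only once its symbol
has been recovered from the code. -/
theorem Term.sigma_eq_of_code_eq {s s' : Sg.Srt} (t : Term Sg s) (t' : Term Sg s')
    (ht : t.code = t'.code) : (⟨s, t⟩ : (s : Sg.Srt) × Term Sg s) = ⟨s', t'⟩ := by
  induction t generalizing s' with
  | var s n =>
    cases t' with
    | var s' n' =>
      simp only [Term.code, Nat.pair_eq_pair, true_and] at ht
      obtain rfl := num_injective _ ht.1
      rw [ht.2]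
    | app f args => simp [Term.code] at ht
  | app f args ih =>
    cases t' with
    | var s' n' => simp [Term.code] at ht
    | app f' args' =>
      simp only [Term.code, Nat.pair_eq_pair, true_and] at ht
      obtain rfl := num_injective _ ht.1
      have := List.ofFn_injective (Encodable.encode_injective ht.2)
      have : args = args' := by
        funext i
        have := ih i (args' i) (congrFun this i)
        exact eq_of_heq (Sigma.mk.inj this).2
      rw [this]

theorem Term.code_injective {s : Sg.Srt} : Function.Injective (Term.code : Term Sg s → ℕ) :=
  fun t t' ht => eq_of_heq (Sigma.mk.inj (t.sigma_eq_of_code_eq t' ht)).2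

theorem QF.code_injective : Function.Injective (QF.code : QF Sg → ℕ) := by
  intro φ
  induction φ with
  | eq t t' =>
    intro ψ h
    cases ψ <;> simp [QF.code] at h
    obtain ⟨hs, h₁, h₂⟩ := h
    obtain rfl := num_injective _ hs
    rw [Term.code_injective h₁, Term.code_injective h₂]
  | pred P args =>
    intro ψ h
    cases ψ <;> simp [QF.code, -List.ofFn_inj] at h
    obtain ⟨hP, h⟩ := h
    obtain rfl := num_injective _ hP
    have h := List.ofFn_injective h
    have : args = _ := funext fun i => Term.code_injective (congrFun h i)
    rw [this]
  | tru => intro ψ h; cases ψ <;> simp [QF.code] at h ⊢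
  | fls => intro ψ h; cases ψ <;> simp [QF.code] at h ⊢
  | neg φ ih =>
    intro ψ h
    cases ψ <;> simp [QF.code] at h ⊢
    exact ih h
  | and φ ψ ih₁ ih₂ =>
    intro ψ h
    cases ψ <;> simp [QF.code] at h ⊢
    exact ⟨ih₁ h.1, ih₂ h.2⟩
  | or φ ψ ih₁ ih₂ =>
    intro ψ h
    cases ψ <;> simp [QF.code] at h ⊢
    exact ⟨ih₁ h.1, ih₂ h.2⟩

end Codes

/-- The conjunction of a list of formulas. -/
def QF.bigAnd (l : List (QF Sg)) : QF Sg := l.foldr QF.and QF.tru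

/-- The disjunction of a list of formulas. -/
def QF.bigOr (l : List (QF Sg)) : QF Sg := l.foldr QF.or QF.fls

theorem QF.holds_bigAnd {M : Sg.Srt → Type u} (O : Ops Sg M) (v : (s : Sg.Srt) → ℕ → M s)
    (l : List (QF Sg)) : (QF.bigAnd l).holds O v ↔ ∀ φ ∈ l, φ.holds O v := by
  induction l with
  | nil => simp [QF.bigAnd, QF.holds]
  | cons φ l ih =>
    rw [List.forall_mem_cons, ← ih]
    rfl

theorem QF.holds_bigOr {M : Sg.Srt → Type u} (O : Ops Sg M) (v : (s : Sg.Srt) → ℕ → M s)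
    (l : List (QF Sg)) : (QF.bigOr l).holds O v ↔ ∃ φ ∈ l, φ.holds O v := by
  induction l with
  | nil => simp [QF.bigOr, QF.holds]
  | cons φ l ih =>
    rw [List.exists_mem_cons_iff, ← ih]
    rfl

theorem QF.mem_fv_bigAnd {l : List (QF Sg)} {x : Var Sg} :
    x ∈ (QF.bigAnd l).fv ↔ ∃ φ ∈ l, x ∈ φ.fv := by
  induction l with
  | nil => simp [QF.bigAnd, QF.fv]
  | cons φ l ih =>
    rw [List.exists_mem_cons_iff, ← ih]
    rfl

theorem QF.mem_fv_bigOr {l : List (QF Sg)} {x : Var Sg} :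
    x ∈ (QF.bigOr l).fv ↔ ∃ φ ∈ l, x ∈ φ.fv := by
  induction l with
  | nil => simp [QF.bigOr, QF.fv]
  | cons φ l ih =>
    rw [List.exists_mem_cons_iff, ← ih]
    rfl

theorem QF.termsAreVarsIn_of_conjuncts {S : Set Sg.Srt} (φ : QF Sg)
    (h : ∀ ψ ∈ φ.conjuncts, ψ.TermsAreVarsIn S) : φ.TermsAreVarsIn S := by
  induction φ with
  | tru => trivial
  | and φ ψ ih₁ ih₂ =>
    exact ⟨ih₁ fun χ hχ => h χ (Or.inl hχ), ih₂ fun χ hχ => h χ (Or.inr hχ)⟩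
  | _ => exact h _ rfl

/-- The strong witness property uses nothing else about arrangements. -/
theorem IsArrangement.termsAreVarsIn {S : Set Sg.Srt} {V : Finset (Var Sg)} {δ : QF Sg}
    (h : IsArrangement V δ) (hV : ∀ x ∈ V, x.1 ∈ S) : δ.TermsAreVarsIn S := by
  obtain ⟨E, hE⟩ := h
  refine δ.termsAreVarsIn_of_conjuncts fun ψ hψ => ?_
  rw [hE] at hψ
  obtain ⟨s, x, y, ⟨-, rfl⟩ | ⟨-, rfl⟩⟩ := hψ
  · exact ⟨⟨hV _ x.2, _, rfl⟩, ⟨hV _ y.2, _, rfl⟩⟩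
  · exact ⟨⟨hV _ x.2, _, rfl⟩, ⟨hV _ y.2, _, rfl⟩⟩

/-- It suffices to change the values of the variables outside of `φ`. -/
theorem Interpretation.satEx_of_agree (I : Interpretation.{u} Sg) (φ ψ : QF Sg)
    (v : (s : Sg.Srt) → ℕ → I.dom s)
    (hv : ∀ s n, (⟨s, n⟩ : Var Sg) ∈ φ.fv → v s n = I.val s n) (h : ψ.holds I.ops v) :
    I.SatEx (ψ.fv \ φ.fv) ψ := by
  classical
  refine ⟨fun s n => if (⟨s, n⟩ : Var Sg) ∈ ψ.fv then v s n else I.val s n, ?_, ?_⟩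
  · intro s n hn
    by_cases h₁ : (⟨s, n⟩ : Var Sg) ∈ ψ.fv
    · have h₂ : (⟨s, n⟩ : Var Sg) ∈ φ.fv := by
        by_contra h₂
        exact hn ⟨h₁, h₂⟩
      simp only [if_pos h₁, hv s n h₂]
    · simp only [if_neg h₁]
  · refine (ψ.holds_congr I.ops fun s n hn => ?_).1 h
    simp only [if_pos hn]

end Formulas

/-- An enumeration of the elements of a finite type, in the order of their numbers. -/
noncomputable def enum {α : Type} (h : Finite α) : List α :=
  List.ofFn (@Finite.equivFin α h).symm

theorem mem_enum {α : Type} (h : Finite α) (a : α) : a ∈ enum h :=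
  List.mem_ofFn.2 ⟨@Finite.equivFin α h a, Equiv.symm_apply_apply _ _⟩

/-! ### Construction of the witness -/

section Witness

variable (Dt : DatatypesSignature)

/-- The variable with base `b` that names the term `t`. -/
noncomputable def nameVar (b : ℕ) {s : Dt.sig.Srt} (t : Term Dt.sig s) : Term Dt.sig s :=
  .var s (Nat.pair b t.code)

/-- The selector term `s_{c,i}(t)`. -/
def selTerm (c : Dt.Con) (i : Fin (Dt.ar c)) (t : Term Dt.sig (.inr (Dt.res c))) :
    Term Dt.sig (Dt.arg c i) :=
  .app (Sg := Dt.sig) (.sel c i) (fun _ => t)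

/-- The formula `t = c(y₁, ..., yₙ)`, where `yᵢ` names `s_{c,i}(t)`. -/
noncomputable def builtBy (b : ℕ) (c : Dt.Con) (t : Term Dt.sig (.inr (Dt.res c))) : QF Dt.sig :=
  .eq t (.app (Sg := Dt.sig) (.con c) (fun i => nameVar Dt b (selTerm Dt c i t)))

open Classical in
/-- The formula `builtBy b c t` if `c` is a constructor of the sort of `t`. -/
noncomputable def builtByOf (b : ℕ) (s : Dt.Struct) (t : Term Dt.sig (.inr s)) (c : Dt.Con) :
    QF Dt.sig :=
  if h : s = Dt.res c then builtBy Dt b c (h ▸ t) else .fls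

/-- The disjunction of `t = c(y₁, ..., yₙ)` over all constructors `c` of the sort of `t`. -/
noncomputable def caseSplit (b : ℕ) (s : Dt.Struct) (t : Term Dt.sig (.inr s)) : QF Dt.sig :=
  .bigOr ((enum Dt.finite_con).map (builtByOf Dt b s t))

/-- The guard of a variable. -/
noncomputable def varGuard (b : ℕ) : (s : Dt.sig.Srt) → ℕ → QF Dt.sig
  | .inl _, _ => .tru
  | .inr s, n => caseSplit Dt b s (.var (Sg := Dt.sig) (.inr s) n)

/-- The guard of a term that is not a variable, without the guards of its proper subterms. -/
noncomputable def appGuard (b : ℕ) : (s : Dt.sig.Srt) → Term Dt.sig s → QF Dt.sig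
  | .inl _, t => .eq (nameVar Dt b t) t
  | .inr s, t => caseSplit Dt b s t

/-- The guard of a term: every subterm of a struct sort is built by a constructor from values of
variables, every subterm of an element sort has the value of a variable. -/
noncomputable def termGuard (b : ℕ) : {s : Dt.sig.Srt} → Term Dt.sig s → QF Dt.sig
  | _, .var s n => varGuard Dt b s n
  | _, .app f args =>
      .and (.bigAnd (List.ofFn fun i => termGuard b (args i)))
        (appGuard Dt b _ (.app (Sg := Dt.sig) f args))

/-- The guard of a formula: the conjunction of the guards of its terms. -/
noncomputable def guard (b : ℕ) : QF Dt.sig → QF Dt.sig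
  | .eq t t' => .and (termGuard Dt b t) (termGuard Dt b t')
  | .pred _ args => .bigAnd (List.ofFn fun i => termGuard Dt b (args i))
  | .tru => .tru
  | .fls => .tru
  | .neg φ => guard b φ
  | .and φ ψ => .and (guard b φ) (guard b ψ)
  | .or φ ψ => .and (guard b φ) (guard b ψ)

/-- The conjunction of `x = x` for one variable `x` of every element sort. -/
noncomputable def elemVars : QF Dt.sig :=
  .bigAnd ((enum Dt.finite_elem).map fun e =>
    .eq (.var (Sg := Dt.sig) (.inl e) 0) (.var (Sg := Dt.sig) (.inl e) 0))

open Classical in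
/-- The formula that the witness adds to `φ`. If `φ` is `(χ ∧ extension χ) ∧ ψ`, only `ψ` needs
guarding. -/
noncomputable def extension : QF Dt.sig → QF Dt.sig
  | .and (.and χ ρ) ψ =>
      let φ : QF Dt.sig := .and (.and χ ρ) ψ
      if ρ = extension χ then .and (elemVars Dt) (guard Dt (φ.code + 1) ψ)
      else .and (elemVars Dt) (guard Dt (φ.code + 1) φ)
  | φ => .and (elemVars Dt) (guard Dt (φ.code + 1) φ)

/-- The witness. -/
noncomputable def witness (φ : QF Dt.sig) : QF Dt.sig := .and φ (extension Dt φ)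

/-- The source of additivity: the part that is already a witness is not guarded again. -/
theorem extension_witness_and (χ ψ : QF Dt.sig) :
    extension Dt (.and (witness Dt χ) ψ) =
      .and (elemVars Dt) (guard Dt ((QF.and (witness Dt χ) ψ).code + 1) ψ) := by
  rw [witness, extension, if_pos rfl]

/-- The two cases in the definition of `extension`. -/
theorem extension_cases (φ : QF Dt.sig) :
    (∃ χ ψ, φ = .and (witness Dt χ) ψ) ∨
      extension Dt φ = .and (elemVars Dt) (guard Dt (φ.code + 1) φ) := by
  by_cases h : ∃ χ ψ, φ = .and (witness Dt χ) ψ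
  · exact Or.inl h
  right
  rcases φ with _ | _ | _ | _ | _ | ⟨φ, ψ⟩ | _ <;> try rfl
  rcases φ with _ | _ | _ | _ | _ | ⟨χ, ρ⟩ | _ <;> try rfl
  rw [extension, if_neg]
  rintro rfl
  exact h ⟨χ, ψ, rfl⟩

end Witness

/-! ### Trees, and maps between trees that preserve truth -/

section Trees

variable {Dt : DatatypesData} {D D' : Dt.Elem → Type u}

theorem Tree.exists_leaf {e : Dt.Elem} (x : Tree Dt D (.inl e)) : ∃ a, x = .leaf a := by
  cases x with
  | leaf a => exact ⟨a, rfl⟩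

theorem Tree.leaf_injective {e : Dt.Elem} :
    Function.Injective (Tree.leaf : D e → Tree Dt D (.inl e)) := by
  intro a b h
  cases h
  rfl

theorem Tree.node_injective {c : Dt.Con} :
    Function.Injective (Tree.node c : _ → Tree Dt D (.inr (Dt.res c))) := by
  intro a b h
  injection h

/-- The constructor at the root. -/
def Tree.root {D : Dt.Elem → Type*} : {s : Dt.Elem ⊕ Dt.Struct} → Tree Dt D s → Option Dt.Con
  | _, .leaf _ => none
  | _, .node c _ => some c

theorem Tree.exists_args_of_root {s : Dt.Elem ⊕ Dt.Struct} (x : Tree Dt D s) {c : Dt.Con}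
    (hx : x.root = some c) : ∃ (h : s = .inr (Dt.res c)) (args : _), h ▸ x = Tree.node c args := by
  cases x with
  | leaf a => simp [Tree.root] at hx
  | node c' args =>
    simp only [Tree.root, Option.some.injEq] at hx
    subst hx
    exact ⟨rfl, args, rfl⟩

theorem Tree.root_eq_some_iff {c : Dt.Con} (x : Tree Dt D (.inr (Dt.res c))) :
    x.root = some c ↔ ∃ args, x = .node c args := by
  constructor
  · intro hx
    obtain ⟨h, args, hargs⟩ := x.exists_args_of_root hx
    exact ⟨args, hargs⟩
  · rintro ⟨args, rfl⟩
    rfl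

theorem Tree.exists_node {s : Dt.Struct} (x : Tree Dt D (.inr s)) :
    ∃ (c : Dt.Con) (h : s = Dt.res c) (args : _), h ▸ x = Tree.node c args := by
  cases x with
  | node c args => exact ⟨c, rfl, args, rfl⟩

/-- The map on trees induced by a map on elements. -/
def Tree.map {D : Dt.Elem → Type*} {D' : Dt.Elem → Type u} (g : ∀ e, D e → D' e) :
    {s : Dt.Elem ⊕ Dt.Struct} → Tree Dt D s → Tree Dt D' s
  | _, .leaf a => .leaf (g _ a)
  | _, .node c args => .node c fun i => (args i).map g

theorem Tree.root_map {D : Dt.Elem → Type*} (g : ∀ e, D e → D' e) {s : Dt.Elem ⊕ Dt.Struct}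
    (x : Tree Dt D s) : (x.map g).root = x.root := by
  cases x <;> rfl

theorem Tree.map_injective {g : ∀ e, D e → D' e} (hg : ∀ e, Function.Injective (g e))
    {s : Dt.Elem ⊕ Dt.Struct} : Function.Injective (Tree.map g : Tree Dt D s → Tree Dt D' s) := by
  intro x
  induction x with
  | leaf a =>
    intro y h
    obtain ⟨b, rfl⟩ := y.exists_leaf
    simp only [Tree.map] at h
    rw [hg _ (Tree.leaf_injective h)]
  | node c args ih =>
    intro y h
    obtain ⟨args', rfl⟩ := y.root_eq_some_iff.1 (by rw [← y.root_map g, ← h]; rfl)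
    simp only [Tree.map] at h
    congr 1
    funext i
    exact ih i (congrFun (Tree.node_injective h) i)

/-- The trees all of whose immediate subtrees are in `V`, together with the leaves in `V`. -/
def Tame (V : (s : Dt.Elem ⊕ Dt.Struct) → Set (Tree Dt D s)) :
    {s : Dt.Elem ⊕ Dt.Struct} → Tree Dt D s → Prop
  | _, .leaf a => .leaf a ∈ V _
  | _, .node _ args => ∀ i, args i ∈ V _

variable {V : (s : Dt.Elem ⊕ Dt.Struct) → Set (Tree Dt D s)}

theorem tame_of_elem {e : Dt.Elem} {x : Tree Dt D (.inl e)} (hx : x ∈ V _) : Tame V x := by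
  cases x with
  | leaf a => exact hx

/-- With this choice of V a transfer preserves all formulas, which is the case needed for
smoothness. -/
theorem tame_univ {s : Dt.Elem ⊕ Dt.Struct} (x : Tree Dt D s) : Tame (fun _ => Set.univ) x := by
  cases x with
  | leaf a => trivial
  | node c args => exact fun i => trivial

/-- `h` transfers the truth of formulas whose terms have tame values. -/
structure IsTransfer (V : (s : Dt.Elem ⊕ Dt.Struct) → Set (Tree Dt D s))
    (h : (s : Dt.Elem ⊕ Dt.Struct) → Tree Dt D s → Tree Dt D' s)
    (O : Ops Dt.sig (Tree Dt D)) (O' : Ops Dt.sig (Tree Dt D')) : Prop where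
  source : IsDatatypesOps Dt D O
  target : IsDatatypesOps Dt D' O'
  node : ∀ (c : Dt.Con) (args : (i : Fin (Dt.ar c)) → Tree Dt D (Dt.arg c i)),
    (∀ i, args i ∈ V _) → h _ (.node c args) = .node c fun i => h _ (args i)
  inj : ∀ (s : Dt.Elem ⊕ Dt.Struct) (x y : Tree Dt D s), Tame V x → Tame V y →
    h s x = h s y → x = y
  sel : ∀ (c : Dt.Con) (i : Fin (Dt.ar c)) (x : Tree Dt D (.inr (Dt.res c))), Tame V x →
    O'.func (.sel c i) (fun _ => h _ x) = h _ (O.func (.sel c i) fun _ => x)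

open Classical in
/-- The interpretation of the symbols that makes `h` a transfer. -/
noncomputable def transferOps (V : (s : Dt.Elem ⊕ Dt.Struct) → Set (Tree Dt D s))
    (h : (s : Dt.Elem ⊕ Dt.Struct) → Tree Dt D s → Tree Dt D' s)
    (hne : ∀ s, Nonempty (Tree Dt D' s)) (O : Ops Dt.sig (Tree Dt D)) :
    Ops Dt.sig (Tree Dt D') where
  func := fun f => match f with
    | .con c => fun args => .node c args
    | .sel c i => fun args =>
      if hx : ∃ x : Tree Dt D (.inr (Dt.res c)), Tame V x ∧ h _ x = args 0 then
        h _ (O.func (.sel c i) fun _ => hx.choose)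
      else if hy : ∃ ts, args 0 = .node c ts then hy.choose i
      else (hne _).some
  pred := fun P => match P with
    | .is c => fun args => ∃ ts, args 0 = .node c ts

theorem root_eq_of_tame {V : (s : Dt.Elem ⊕ Dt.Struct) → Set (Tree Dt D s)}
    {h : (s : Dt.Elem ⊕ Dt.Struct) → Tree Dt D s → Tree Dt D' s}
    (hnode : ∀ (c : Dt.Con) (args : (i : Fin (Dt.ar c)) → Tree Dt D (Dt.arg c i)),
      (∀ i, args i ∈ V _) → h _ (.node c args) = .node c fun i => h _ (args i))
    {s : Dt.Elem ⊕ Dt.Struct} {x : Tree Dt D s} (hx : Tame V x) : (h s x).root = x.root := by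
  cases x with
  | leaf a =>
    obtain ⟨b, hb⟩ := (h _ (Tree.leaf a)).exists_leaf
    rw [hb]
    rfl
  | node c args =>
    rw [hnode c args hx]
    rfl

/-- On images of tame trees the selectors are copied through `h`, unambiguously by injectivity. This
respects the selector axiom: a tame preimage of a node built by c is itself built by c, with
arguments mapped to those of the image. -/
theorem isTransfer_transferOps {V : (s : Dt.Elem ⊕ Dt.Struct) → Set (Tree Dt D s)}
    {h : (s : Dt.Elem ⊕ Dt.Struct) → Tree Dt D s → Tree Dt D' s}
    (hne : ∀ s, Nonempty (Tree Dt D' s)) {O : Ops Dt.sig (Tree Dt D)}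
    (hO : IsDatatypesOps Dt D O)
    (hnode : ∀ (c : Dt.Con) (args : (i : Fin (Dt.ar c)) → Tree Dt D (Dt.arg c i)),
      (∀ i, args i ∈ V _) → h _ (.node c args) = .node c fun i => h _ (args i))
    (hinj : ∀ (s : Dt.Elem ⊕ Dt.Struct) (x y : Tree Dt D s), Tame V x → Tame V y →
      h s x = h s y → x = y) :
    IsTransfer V h O (transferOps V h hne O) where
  source := hO
  node := hnode
  inj := hinj
  sel := by
    intro c i x hx
    have hex : ∃ y : Tree Dt D (.inr (Dt.res c)), Tame V y ∧ h _ y = h _ x := ⟨x, hx, rfl⟩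
    have hy : hex.choose = x := hinj _ _ _ hex.choose_spec.1 hx hex.choose_spec.2
    simp only [transferOps]
    rw [dif_pos hex]
    congr 2
    funext _
    exact hy
  target :=
    { con := fun c args => rfl
      sel := by
        intro c args i
        simp only [transferOps]
        by_cases hex : ∃ y : Tree Dt D (.inr (Dt.res c)), Tame V y ∧ h _ y = Tree.node c args
        · rw [dif_pos hex]
          obtain ⟨h₁, h₂⟩ := hex.choose_spec
          obtain ⟨ts, hts⟩ := (Tree.root_eq_some_iff hex.choose).1
            (by rw [← root_eq_of_tame hnode h₁, h₂]; rfl)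
          rw [hts] at h₁ h₂ ⊢
          rw [hO.sel]
          rw [hnode c ts h₁] at h₂
          exact congrFun (Tree.node_injective h₂) i
        · rw [dif_neg hex]
          have hy : ∃ ts, Tree.node c args = Tree.node (D := D') c ts := ⟨args, rfl⟩
          rw [dif_pos hy]
          exact (congrFun (Tree.node_injective hy.choose_spec) i).symm
      tester := fun c t => Iff.rfl }

/-- All subterms have tame values. -/
def Term.Tame (V : (s : Dt.Elem ⊕ Dt.Struct) → Set (Tree Dt D s)) (O : Ops Dt.sig (Tree Dt D))
    (v : (s : Dt.sig.Srt) → ℕ → Tree Dt D s) : {s : Dt.sig.Srt} → Term Dt.sig s → Prop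
  | s, .var _ n => Polite.Tame V (v s n)
  | _, .app f args => (∀ i, (args i).Tame V O v) ∧
      Polite.Tame V (O.func f fun i => (args i).eval O v)

/-- All subterms of the formula have tame values. -/
def QF.Tame (V : (s : Dt.Elem ⊕ Dt.Struct) → Set (Tree Dt D s)) (O : Ops Dt.sig (Tree Dt D))
    (v : (s : Dt.sig.Srt) → ℕ → Tree Dt D s) : QF Dt.sig → Prop
  | .eq t t' => t.Tame V O v ∧ t'.Tame V O v
  | .pred _ args => ∀ i, (args i).Tame V O v
  | .tru => True
  | .fls => True
  | .neg φ => φ.Tame V O v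
  | .and φ ψ => φ.Tame V O v ∧ ψ.Tame V O v
  | .or φ ψ => φ.Tame V O v ∧ ψ.Tame V O v

theorem Term.Tame.eval {O : Ops Dt.sig (Tree Dt D)} {v : (s : Dt.sig.Srt) → ℕ → Tree Dt D s}
    {s : Dt.sig.Srt} {t : Term Dt.sig s} (ht : t.Tame V O v) : Polite.Tame V (t.eval O v) := by
  cases t with
  | var s n => exact ht
  | app f args => exact ht.2

theorem Term.tame_univ (O : Ops Dt.sig (Tree Dt D)) (v : (s : Dt.sig.Srt) → ℕ → Tree Dt D s)
    {s : Dt.sig.Srt} (t : Term Dt.sig s) : t.Tame (fun _ => Set.univ) O v := by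
  induction t with
  | var s n => exact Polite.tame_univ _
  | app f args ih => exact ⟨ih, Polite.tame_univ _⟩

theorem QF.tame_univ (O : Ops Dt.sig (Tree Dt D)) (v : (s : Dt.sig.Srt) → ℕ → Tree Dt D s)
    (φ : QF Dt.sig) : φ.Tame (fun _ => Set.univ) O v := by
  induction φ with
  | eq t t' => exact ⟨t.tame_univ O v, t'.tame_univ O v⟩
  | pred P args => exact fun i => (args i).tame_univ O v
  | tru => trivial
  | fls => trivial
  | neg φ ih => exact ih
  | and φ ψ ih₁ ih₂ => exact ⟨ih₁, ih₂⟩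
  | or φ ψ ih₁ ih₂ => exact ⟨ih₁, ih₂⟩

section Transfer

variable {h : (s : Dt.Elem ⊕ Dt.Struct) → Tree Dt D s → Tree Dt D' s}
  {O : Ops Dt.sig (Tree Dt D)} {O' : Ops Dt.sig (Tree Dt D')}

theorem IsTransfer.eval (H : IsTransfer V h O O') (v : (s : Dt.sig.Srt) → ℕ → Tree Dt D s)
    {s : Dt.sig.Srt} (t : Term Dt.sig s) (ht : t.Tame V O v) :
    t.eval O' (fun s n => h s (v s n)) = h s (t.eval O v) := by
  induction t with
  | var s n => rfl
  | app f args ih =>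
    have hargs : (fun i => (args i).eval O' fun s n => h s (v s n)) =
        fun i => h _ ((args i).eval O v) := funext fun i => ih i (ht.1 i)
    simp only [Term.eval]
    rw [hargs]
    cases f with
    | con c =>
      -- Tameness of a node says exactly that its arguments lie in V, which is when `h` commutes
      -- with the constructor.
      have ht₂ := ht.2
      rw [H.source.con] at ht₂
      rw [H.source.con, H.target.con]
      exact (H.node c _ ht₂).symm
    | sel c i =>
      have hconst : ∀ {M : Dt.sig.Srt → Type u}
          (a : (j : Fin 1) → M (.inr (Dt.res c))), a = fun _ => a 0 :=
        fun a => funext fun j => by rw [Subsingleton.elim j 0]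
      rw [hconst (M := Tree Dt D') fun i => h _ ((args i).eval O v),
        hconst (M := Tree Dt D) fun i => (args i).eval O v]
      exact H.sel c i _ (ht.1 0).eval

theorem IsTransfer.holds (H : IsTransfer V h O O') (v : (s : Dt.sig.Srt) → ℕ → Tree Dt D s)
    (φ : QF Dt.sig) (hφ : φ.Tame V O v) :
    φ.holds O' (fun s n => h s (v s n)) ↔ φ.holds O v := by
  induction φ with
  | eq t t' =>
    simp only [QF.holds]
    rw [H.eval v t hφ.1, H.eval v t' hφ.2]
    exact ⟨H.inj _ _ _ hφ.1.eval hφ.2.eval, fun e => by rw [e]⟩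
  | pred P args =>
    cases P with
    | is c =>
      have hargs : (fun i => (args i).eval O' fun s n => h s (v s n)) =
          fun _ => h _ ((args 0).eval O v) := funext fun i => by
        rw [Subsingleton.elim i (0 : Fin 1)]
        exact H.eval v _ (hφ 0)
      have hargs' : (fun i => (args i).eval O v) = fun _ => (args 0).eval O v :=
        funext fun i => by rw [Subsingleton.elim i (0 : Fin 1)]
      simp only [QF.holds]
      rw [hargs, hargs']
      refine (H.target.tester c _).trans (Iff.trans ?_ (H.source.tester c _).symm)
      rw [← Tree.root_eq_some_iff, ← Tree.root_eq_some_iff, root_eq_of_tame H.node (hφ 0).eval]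
  | tru => rfl
  | fls => rfl
  | neg φ ih => exact not_congr (ih hφ)
  | and φ ψ ih₁ ih₂ => exact and_congr (ih₁ hφ.1) (ih₂ hφ.2)
  | or φ ψ ih₁ ih₂ => exact or_congr (ih₁ hφ.1) (ih₂ hφ.2)

end Transfer

end Trees

/-! ### Smoothness -/

theorem mk_tree_elem {Dt : DatatypesData} (D : Dt.Elem → Type u) (e : Dt.Elem) :
    Cardinal.mk (Tree Dt D (.inl e)) = Cardinal.mk (D e) :=
  (Cardinal.mk_congr (Equiv.ofBijective (Tree.leaf : D e → Tree Dt D (.inl e))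
    ⟨Tree.leaf_injective, fun x => (x.exists_leaf).imp fun _ h => h.symm⟩)).symm

/-- Embed the elements into sets of the prescribed cardinalities; the induced map on trees is
injective and commutes with all constructors, so it is a transfer without any tameness restriction.
-/
theorem DatatypesSignature.smooth (Dt : DatatypesSignature) :
    Smooth (DatatypesSignature.theory.{u} Dt) Dt.elemSorts := by
  rintro φ ⟨A, v⟩ ⟨D, hD, O, hO, hA⟩ hφ κ hκ
  dsimp only at hA
  subst hA
  let κ' : Dt.Elem → Cardinal.{u} := fun e => κ ⟨.inl e, e, rfl⟩
  have hle : ∀ e, Cardinal.mk (D e) ≤ Cardinal.mk (κ' e).out := fun e => by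
    rw [Cardinal.mk_out, ← mk_tree_elem D e]
    exact hκ ⟨.inl e, e, rfl⟩
  have g : ∀ e, D e ↪ (κ' e).out := fun e => Classical.choice ((Cardinal.le_def _ _).1 (hle e))
  have hD' : ∀ e, Nonempty (κ' e).out := fun e => (hD e).map (g e)
  have H := isTransfer_transferOps (V := fun _ => Set.univ)
    (h := fun s => Tree.map fun e => g e) (Dt.tree_nonempty _ hD') hO
    (fun c args _ => rfl) (fun s x y _ _ hxy => Tree.map_injective (fun e => (g e).injective) hxy)
  refine ⟨⟨⟨_, Dt.tree_nonempty _ hD', _⟩, fun s n => (v s n).map fun e => g e⟩,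
    ⟨_, hD', _, H.target, rfl⟩, (H.holds v φ (φ.tame_univ O v)).2 hφ, ?_⟩
  rintro ⟨s, e, rfl⟩
  exact (mk_tree_elem _ e).trans (Cardinal.mk_out _)

/-! ### What the guards say, and their preservation under transfer -/

section Guards

variable {Dt : DatatypesSignature} {D D' : Dt.Elem → Type u}

section CaseSplit

variable {O : Ops Dt.sig (Tree Dt.toDatatypesData D)}
  {v : (s : Dt.sig.Srt) → ℕ → Tree Dt.toDatatypesData D s}

theorem holds_caseSplit {b : ℕ} {s : Dt.Struct} {t : Term Dt.sig (.inr s)} :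
    (caseSplit Dt b s t).holds O v ↔ ∃ c, (builtByOf Dt b s t c).holds O v := by
  simp [caseSplit, QF.holds_bigOr, mem_enum]

theorem fv_builtByOf_subset {b : ℕ} {s : Dt.Struct} {t : Term Dt.sig (.inr s)} (c : Dt.Con) :
    (builtByOf Dt b s t c).fv ⊆ (caseSplit Dt b s t).fv := fun _ hx =>
  QF.mem_fv_bigOr.2 ⟨_, List.mem_map.2 ⟨c, mem_enum _ c, rfl⟩, hx⟩

theorem builtByOf_self {b : ℕ} {c : Dt.Con} {t : Term Dt.sig (.inr (Dt.res c))} :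
    builtByOf Dt b (Dt.res c) t c = builtBy Dt b c t := by
  rw [builtByOf, dif_pos rfl]

/-- A case split provides a constructor and variables for its arguments. -/
theorem exists_of_holds_caseSplit (hO : IsDatatypesOps Dt.toDatatypesData D O) {b : ℕ}
    {s : Dt.Struct} {t : Term Dt.sig (.inr s)} (h : (caseSplit Dt b s t).holds O v) :
    ∃ (c : Dt.Con) (hs : s = Dt.res c),
      hs ▸ t.eval O v = Tree.node c fun i => v _ (Nat.pair b (selTerm Dt c i (hs ▸ t)).code) := by
  obtain ⟨c, hc⟩ := holds_caseSplit.1 h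
  by_cases hs : s = Dt.res c
  · subst hs
    rw [builtByOf_self] at hc
    exact ⟨c, rfl, hc.trans (hO.con c _)⟩
  · rw [builtByOf, dif_neg hs] at hc
    exact hc.elim

theorem holds_caseSplit_of_eval (hO : IsDatatypesOps Dt.toDatatypesData D O) {b : ℕ} {c : Dt.Con}
    {t : Term Dt.sig (.inr (Dt.res c))}
    (h : t.eval O v = Tree.node c fun i => v _ (Nat.pair b (selTerm Dt c i t).code)) :
    (caseSplit Dt b _ t).holds O v := by
  refine holds_caseSplit.2 ⟨c, ?_⟩
  rw [builtByOf_self]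
  exact h.trans (hO.con c _).symm

theorem nameVar_mem_fv_caseSplit {b : ℕ} {c : Dt.Con} {t : Term Dt.sig (.inr (Dt.res c))}
    (i : Fin (Dt.ar c)) :
    (⟨Dt.arg c i, Nat.pair b (selTerm Dt c i t).code⟩ : Var Dt.sig) ∈
      (caseSplit Dt b _ t).fv := by
  refine fv_builtByOf_subset c ?_
  rw [builtByOf_self]
  exact Or.inr ⟨i, rfl⟩

end CaseSplit

/-- The values of the variables in `F`. -/
def values (F : Set (Var Dt.sig)) (v : (s : Dt.sig.Srt) → ℕ → Tree Dt.toDatatypesData D s)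
    (s : Dt.Elem ⊕ Dt.Struct) : Set (Tree Dt.toDatatypesData D s) :=
  {x | ∃ n, (⟨s, n⟩ : Var Dt.sig) ∈ F ∧ v s n = x}

section Sound

variable {O : Ops Dt.sig (Tree Dt.toDatatypesData D)}
  {v : (s : Dt.sig.Srt) → ℕ → Tree Dt.toDatatypesData D s} {F : Set (Var Dt.sig)} {b : ℕ}

/-- The true disjunct exhibits the immediate subtrees of the value as values of name variables. -/
theorem tame_of_holds_caseSplit (hO : IsDatatypesOps Dt.toDatatypesData D O) {s : Dt.Struct}
    {t : Term Dt.sig (.inr s)} (h : (caseSplit Dt b s t).holds O v)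
    (hF : (caseSplit Dt b s t).fv ⊆ F) : Tame (values F v) (t.eval O v) := by
  obtain ⟨c, rfl, hc⟩ := exists_of_holds_caseSplit hO h
  rw [show t.eval O v = _ from hc]
  exact fun i => ⟨_, hF (nameVar_mem_fv_caseSplit i), rfl⟩

theorem tame_of_holds_appGuard (hO : IsDatatypesOps Dt.toDatatypesData D O) {s : Dt.sig.Srt}
    {t : Term Dt.sig s} (h : (appGuard Dt b s t).holds O v)
    (hF : (appGuard Dt b s t).fv ⊆ F) : Tame (values F v) (t.eval O v) := by
  rcases s with e | s
  · exact tame_of_elem ⟨_, hF (Or.inl rfl), h⟩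
  · exact tame_of_holds_caseSplit hO h hF

theorem tame_of_holds_termGuard (hO : IsDatatypesOps Dt.toDatatypesData D O) {s : Dt.sig.Srt}
    (t : Term Dt.sig s) (h : (termGuard Dt b t).holds O v) (htF : t.fv ⊆ F)
    (hF : (termGuard Dt b t).fv ⊆ F) : t.Tame (values F v) O v := by
  induction t with
  | var s n =>
    rcases s with e | s
    · exact tame_of_elem ⟨n, htF rfl, rfl⟩
    · exact tame_of_holds_caseSplit (t := .var (Sg := Dt.sig) (.inr s) n) hO h hF
  | app f args ih =>
    refine ⟨fun i => ih i ?_ (fun x hx => htF ⟨i, hx⟩) fun x hx => hF (Or.inl ?_), ?_⟩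
    · exact (QF.holds_bigAnd _ _ _).1 h.1 _ (List.mem_ofFn.2 ⟨i, rfl⟩)
    · exact QF.mem_fv_bigAnd.2 ⟨_, List.mem_ofFn.2 ⟨i, rfl⟩, hx⟩
    · exact tame_of_holds_appGuard hO h.2 fun x hx => hF (Or.inr hx)

theorem tame_of_holds_guard (hO : IsDatatypesOps Dt.toDatatypesData D O) (φ : QF Dt.sig)
    (h : (guard Dt b φ).holds O v) (hφ : φ.fv ⊆ F) (hF : (guard Dt b φ).fv ⊆ F) :
    φ.Tame (values F v) O v := by
  induction φ with
  | eq t t' =>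
    rw [QF.fv, Set.union_subset_iff] at hφ
    rw [guard, QF.fv, Set.union_subset_iff] at hF
    exact ⟨tame_of_holds_termGuard hO t h.1 hφ.1 hF.1,
      tame_of_holds_termGuard hO t' h.2 hφ.2 hF.2⟩
  | pred P args =>
    intro i
    refine tame_of_holds_termGuard (b := b) hO (args i) ?_ (fun x hx => hφ ⟨i, hx⟩) fun x hx => hF ?_
    · exact (QF.holds_bigAnd _ _ _).1 h _ (List.mem_ofFn.2 ⟨i, rfl⟩)
    · exact QF.mem_fv_bigAnd.2 ⟨_, List.mem_ofFn.2 ⟨i, rfl⟩, hx⟩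
  | tru => trivial
  | fls => trivial
  | neg φ ih => exact ih h hφ hF
  | and φ ψ ih₁ ih₂ =>
    rw [QF.fv, Set.union_subset_iff] at hφ
    rw [guard, QF.fv, Set.union_subset_iff] at hF
    exact ⟨ih₁ h.1 hφ.1 hF.1, ih₂ h.2 hφ.2 hF.2⟩
  | or φ ψ ih₁ ih₂ =>
    rw [QF.fv, Set.union_subset_iff] at hφ
    rw [guard, QF.fv, Set.union_subset_iff] at hF
    exact ⟨ih₁ h.1 hφ.1 hF.1, ih₂ h.2 hφ.2 hF.2⟩

variable {h : (s : Dt.Elem ⊕ Dt.Struct) → Tree Dt.toDatatypesData D s →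
    Tree Dt.toDatatypesData D' s} {O' : Ops Dt.sig (Tree Dt.toDatatypesData D')}

/-- `IsTransfer.holds` does not apply to a guard, since the name variables are themselves unguarded
and may have values that are not tame. It suffices that these values lie in V, where `h` commutes
with the constructor. -/
theorem IsTransfer.holds_caseSplit (H : IsTransfer (values F v) h O O') {s : Dt.Struct}
    {t : Term Dt.sig (.inr s)} (ht : t.Tame (values F v) O v)
    (hg : (caseSplit Dt b s t).holds O v) (hF : (caseSplit Dt b s t).fv ⊆ F) :
    (caseSplit Dt b s t).holds O' fun s n => h s (v s n) := by
  obtain ⟨c, rfl, hc⟩ := exists_of_holds_caseSplit H.source hg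
  refine holds_caseSplit_of_eval H.target ?_
  rw [H.eval v t ht, show t.eval O v = _ from hc]
  exact H.node c _ fun i => ⟨_, hF (nameVar_mem_fv_caseSplit i), rfl⟩

theorem IsTransfer.holds_termGuard (H : IsTransfer (values F v) h O O') {s : Dt.sig.Srt}
    (t : Term Dt.sig s) (hg : (termGuard Dt b t).holds O v) (htF : t.fv ⊆ F)
    (hF : (termGuard Dt b t).fv ⊆ F) :
    (termGuard Dt b t).holds O' fun s n => h s (v s n) := by
  induction t with
  | var s n =>
    rcases s with e | s
    · trivial
    · exact H.holds_caseSplit (t := .var (Sg := Dt.sig) (.inr s) n)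
        (tame_of_holds_termGuard H.source _ hg htF hF) hg hF
  | app f args ih =>
    have ht := tame_of_holds_termGuard H.source _ hg htF hF
    refine ⟨(QF.holds_bigAnd _ _ _).2 ?_, ?_⟩
    · intro φ hφ
      obtain ⟨i, rfl⟩ := List.mem_ofFn.1 hφ
      refine ih i ?_ (fun x hx => htF ⟨i, hx⟩) fun x hx => hF (Or.inl ?_)
      · exact (QF.holds_bigAnd _ _ _).1 hg.1 _ hφ
      · exact QF.mem_fv_bigAnd.2 ⟨_, hφ, hx⟩
    · have hg₂ := hg.2
      have hF₂ : (appGuard Dt b _ (.app (Sg := Dt.sig) f args)).fv ⊆ F :=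
        fun x hx => hF (Or.inr hx)
      revert ht hg₂ hF₂
      -- Forgetting that the term is an application frees its sort for the case distinction.
      generalize Term.app (Sg := Dt.sig) f args = t
      generalize Dt.sig.res f = s at t
      intro ht hg₂ hF₂
      rcases s with e | s
      · exact (congrArg (h _) hg₂).trans (H.eval v t ht).symm
      · exact H.holds_caseSplit ht hg₂ hF₂

theorem IsTransfer.holds_guard (H : IsTransfer (values F v) h O O') (φ : QF Dt.sig)
    (hg : (guard Dt b φ).holds O v) (hφ : φ.fv ⊆ F) (hF : (guard Dt b φ).fv ⊆ F) :
    (guard Dt b φ).holds O' fun s n => h s (v s n) := by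
  induction φ with
  | eq t t' =>
    rw [QF.fv, Set.union_subset_iff] at hφ
    rw [guard, QF.fv, Set.union_subset_iff] at hF
    exact ⟨H.holds_termGuard t hg.1 hφ.1 hF.1, H.holds_termGuard t' hg.2 hφ.2 hF.2⟩
  | pred P args =>
    refine (QF.holds_bigAnd _ _ _).2 fun φ hφ' => ?_
    obtain ⟨i, rfl⟩ := List.mem_ofFn.1 hφ'
    refine H.holds_termGuard (args i) ?_ (fun x hx => hφ ⟨i, hx⟩) fun x hx => hF ?_
    · exact (QF.holds_bigAnd _ _ _).1 hg _ hφ'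
    · exact QF.mem_fv_bigAnd.2 ⟨_, hφ', hx⟩
  | tru => trivial
  | fls => trivial
  | neg φ ih => exact ih hg hφ hF
  | and φ ψ ih₁ ih₂ =>
    rw [QF.fv, Set.union_subset_iff] at hφ
    rw [guard, QF.fv, Set.union_subset_iff] at hF
    exact ⟨ih₁ hg.1 hφ.1 hF.1, ih₂ hg.2 hφ.2 hF.2⟩
  | or φ ψ ih₁ ih₂ =>
    rw [QF.fv, Set.union_subset_iff] at hφ
    rw [guard, QF.fv, Set.union_subset_iff] at hF
    exact ⟨ih₁ hg.1 hφ.1 hF.1, ih₂ hg.2 hφ.2 hF.2⟩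

theorem holds_elemVars {M : Dt.sig.Srt → Type u} (O : Ops Dt.sig M)
    (v : (s : Dt.sig.Srt) → ℕ → M s) : (elemVars Dt).holds O v := by
  refine (QF.holds_bigAnd _ _ _).2 fun φ hφ => ?_
  obtain ⟨e, -, rfl⟩ := List.mem_map.1 hφ
  rfl

theorem mem_fv_elemVars {x : Var Dt.sig} : x ∈ (elemVars Dt).fv ↔ ∃ e, x = ⟨.inl e, 0⟩ := by
  simp [elemVars, QF.mem_fv_bigAnd, mem_enum, QF.fv, Term.fv]

/-- A formula all of whose terms are variables of element sorts needs no guarding. -/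
theorem guard_of_termsAreVarsIn {M : Dt.sig.Srt → Type u} (O : Ops Dt.sig M)
    (v : (s : Dt.sig.Srt) → ℕ → M s) (ψ : QF Dt.sig) (hψ : ψ.TermsAreVarsIn Dt.elemSorts) :
    (guard Dt b ψ).holds O v ∧ (guard Dt b ψ).fv = ∅ := by
  have hterm : ∀ (s : Dt.sig.Srt) (t : Term Dt.sig s), t.IsVarIn Dt.elemSorts →
      termGuard Dt b t = .tru := by
    rintro s t ⟨⟨e, rfl⟩, n, rfl⟩
    rfl
  induction ψ with
  | eq t t' =>
    rw [guard, hterm _ _ hψ.1, hterm _ _ hψ.2]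
    simp [QF.holds, QF.fv]
  | pred P args =>
    cases P with
    | is c =>
      -- Testers apply to struct sorts only, so this case is void.
      obtain ⟨⟨e, he⟩, -⟩ := hψ (0 : Fin 1)
      cases he
  | tru => simp [guard, QF.holds, QF.fv]
  | fls => simp [guard, QF.holds, QF.fv]
  | neg φ ih => exact ih hψ
  | and φ ψ ih₁ ih₂ =>
    refine ⟨⟨(ih₁ hψ.1).1, (ih₂ hψ.2).1⟩, ?_⟩
    rw [guard, QF.fv, (ih₁ hψ.1).2, (ih₂ hψ.2).2, Set.union_empty]
  | or φ ψ ih₁ ih₂ =>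
    refine ⟨⟨(ih₁ hψ.1).1, (ih₂ hψ.2).1⟩, ?_⟩
    rw [guard, QF.fv, (ih₁ hψ.1).2, (ih₂ hψ.2).2, Set.union_empty]

/-- The truth of a witness transfers, if it has its variables in `F`. -/
theorem IsTransfer.holds_witness (H : IsTransfer (values F v) h O O') :
    ∀ φ : QF Dt.sig, (witness Dt φ).holds O v → (witness Dt φ).fv ⊆ F →
      (witness Dt φ).holds O' fun s n => h s (v s n) := by
  have main : ∀ (φ : QF Dt.sig) (b : ℕ), φ.holds O v → (guard Dt b φ).holds O v → φ.fv ⊆ F →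
      (guard Dt b φ).fv ⊆ F →
      φ.holds O' (fun s n => h s (v s n)) ∧ (guard Dt b φ).holds O' fun s n => h s (v s n) :=
    fun φ b hφ hg hφF hF => ⟨(H.holds v φ (tame_of_holds_guard H.source φ hg hφF hF)).2 hφ,
      H.holds_guard φ hg hφF hF⟩
  intro φ
  -- The recursive case needs the hypothesis for χ inside (χ ∧ `extension` χ) ∧ ψ, which is not an
  -- immediate subformula.
  induction hn : φ.code using Nat.strong_induction_on generalizing φ with
  | _ n ih =>
    intro hφ hF
    rcases extension_cases Dt φ with ⟨χ, ψ, rfl⟩ | he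
    · have he := extension_witness_and Dt χ ψ
      rw [witness, he] at hφ hF ⊢
      obtain ⟨⟨hχ, hψ⟩, -, hg⟩ := hφ
      simp only [QF.fv, Set.union_subset_iff] at hF
      have hlt : χ.code < n := hn ▸ (QF.code_left_lt _ _).trans (QF.code_left_lt _ _)
      obtain ⟨h₁, h₂⟩ := main ψ _ hψ hg hF.1.2 hF.2.2
      exact ⟨⟨ih _ hlt χ rfl hχ hF.1.1, h₁⟩, holds_elemVars _ _, h₂⟩
    · rw [witness, he] at hφ hF ⊢
      obtain ⟨hφ, -, hg⟩ := hφ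
      simp only [QF.fv, Set.union_subset_iff] at hF
      obtain ⟨h₁, h₂⟩ := main φ _ hφ hg hF.1 hF.2.2
      exact ⟨h₁, holds_elemVars _ _, h₂⟩

end Sound

/-! ### Values for the fresh variables -/

section Complete

variable {O : Ops Dt.sig (Tree Dt.toDatatypesData D)}
  {v : (s : Dt.sig.Srt) → ℕ → Tree Dt.toDatatypesData D s} {b : ℕ}

/-- The variables with base `b` have the values of the terms that they name. -/
def NamesTerms (O : Ops Dt.sig (Tree Dt.toDatatypesData D))
    (v : (s : Dt.sig.Srt) → ℕ → Tree Dt.toDatatypesData D s) (b : ℕ) : Prop :=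
  ∀ (s : Dt.sig.Srt) (t : Term Dt.sig s), (∀ x ∈ t.fv, x.2 < b) →
    v s (Nat.pair b t.code) = t.eval O v

/-- The disjunct of the root constructor holds, because the selectors return the arguments of the
root. -/
theorem NamesTerms.holds_caseSplit (hO : IsDatatypesOps Dt.toDatatypesData D O)
    (hv : NamesTerms O v b) {s : Dt.Struct} (t : Term Dt.sig (.inr s))
    (ht : ∀ x ∈ t.fv, x.2 < b) : (caseSplit Dt b s t).holds O v := by
  obtain ⟨c, rfl, args, hargs⟩ := (t.eval O v).exists_node
  refine holds_caseSplit_of_eval hO ?_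
  rw [show t.eval O v = _ from hargs]
  congr 1
  funext i
  rw [hv _ (selTerm Dt c i t) (by rintro x ⟨_, hx⟩; exact ht x hx)]
  have := hO.sel c args i
  rw [← show t.eval O v = _ from hargs] at this
  exact this.symm

theorem NamesTerms.holds_termGuard (hO : IsDatatypesOps Dt.toDatatypesData D O)
    (hv : NamesTerms O v b) {s : Dt.sig.Srt} (t : Term Dt.sig s)
    (ht : ∀ x ∈ t.fv, x.2 < b) : (termGuard Dt b t).holds O v := by
  induction t with
  | var s n =>
    rcases s with e | s
    · trivial
    · exact hv.holds_caseSplit hO (.var (Sg := Dt.sig) (.inr s) n) ht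
  | app f args ih =>
    refine ⟨(QF.holds_bigAnd _ _ _).2 fun φ hφ => ?_, ?_⟩
    · obtain ⟨i, rfl⟩ := List.mem_ofFn.1 hφ
      exact ih i fun x hx => ht x ⟨i, hx⟩
    · revert ht
      generalize Term.app (Sg := Dt.sig) f args = t
      generalize Dt.sig.res f = s at t
      intro ht
      rcases s with e | s
      · exact hv _ t ht
      · exact hv.holds_caseSplit hO t ht

theorem NamesTerms.holds_guard (hO : IsDatatypesOps Dt.toDatatypesData D O)
    (hv : NamesTerms O v b) (φ : QF Dt.sig) (hφ : ∀ x ∈ φ.fv, x.2 < b) :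
    (guard Dt b φ).holds O v := by
  induction φ with
  | eq t t' =>
    exact ⟨hv.holds_termGuard hO t fun x hx => hφ x (Or.inl hx),
      hv.holds_termGuard hO t' fun x hx => hφ x (Or.inr hx)⟩
  | pred P args =>
    refine (QF.holds_bigAnd _ _ _).2 fun φ hφ' => ?_
    obtain ⟨i, rfl⟩ := List.mem_ofFn.1 hφ'
    exact hv.holds_termGuard hO (args i) fun x hx => hφ x ⟨i, hx⟩
  | tru => trivial
  | fls => trivial
  | neg φ ih => exact ih hφ
  | and φ ψ ih₁ ih₂ =>
    exact ⟨ih₁ fun x hx => hφ x (Or.inl hx), ih₂ fun x hx => hφ x (Or.inr hx)⟩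
  | or φ ψ ih₁ ih₂ =>
    exact ⟨ih₁ fun x hx => hφ x (Or.inl hx), ih₂ fun x hx => hφ x (Or.inr hx)⟩

/-- Names have index `Nat.pair b _ ≥ b`, so assigning them does not disturb the terms they name;
injectivity of codes makes the assignment well defined. -/
theorem exists_namesTerms (O : Ops Dt.sig (Tree Dt.toDatatypesData D))
    (v : (s : Dt.sig.Srt) → ℕ → Tree Dt.toDatatypesData D s) (b : ℕ) :
    ∃ w : (s : Dt.sig.Srt) → ℕ → Tree Dt.toDatatypesData D s,
      (∀ s n, n < b → w s n = v s n) ∧ NamesTerms O w b := by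
  classical
  let w : (s : Dt.sig.Srt) → ℕ → Tree Dt.toDatatypesData D s := fun s n =>
    if h : ∃ t : Term Dt.sig s, n = Nat.pair b t.code then h.choose.eval O v else v s n
  have hw : ∀ s n, n < b → w s n = v s n := by
    intro s n hn
    refine dif_neg ?_
    rintro ⟨t, rfl⟩
    exact absurd (Nat.left_le_pair b t.code) (not_le.2 hn)
  refine ⟨w, hw, fun s t ht => ?_⟩
  have hex : ∃ t' : Term Dt.sig s, Nat.pair b t.code = Nat.pair b t'.code := ⟨t, rfl⟩
  have h₁ : w s (Nat.pair b t.code) = hex.choose.eval O v := dif_pos hex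
  rw [h₁, ← Term.code_injective (Nat.pair_eq_pair.1 hex.choose_spec).2]
  exact t.eval_congr O fun s n hn => (hw s n (ht _ hn)).symm

end Complete

/-- Any formula is equivalent to its witness up to the additional variables. -/
theorem exEquivalent_witness (Dt : DatatypesSignature) :
    ExEquivalent (DatatypesSignature.theory.{u} Dt) (witness Dt) := by
  rintro φ ⟨A, v⟩ ⟨D, hD, O, hO, hA⟩
  dsimp only at hA
  subst hA
  constructor
  · intro hφ
    obtain ⟨w, hwv, hw⟩ := exists_namesTerms O v (φ.code + 1)
    have hlt : ∀ x ∈ φ.fv, x.2 < φ.code + 1 := fun x hx =>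
      Nat.lt_succ_of_le (φ.index_le_code hx)
    refine Interpretation.satEx_of_agree _ φ _ w (fun s n hn => hwv s n (hlt _ hn)) ⟨?_, ?_⟩
    · exact (φ.holds_congr O fun s n hn => hwv s n (hlt _ hn)).2 hφ
    · rcases extension_cases Dt φ with ⟨χ, ψ, rfl⟩ | he
      · rw [extension_witness_and]
        exact ⟨holds_elemVars _ _, hw.holds_guard hO ψ fun x hx => hlt x (Or.inr hx)⟩
      · rw [he]
        exact ⟨holds_elemVars _ _, hw.holds_guard hO φ hlt⟩
  · rintro ⟨w, hw, hφ, -⟩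
    exact (φ.holds_congr O fun s n hn => hw s n fun h => h.2 hn).1 hφ

/-- The second application adds only a trivial guard without variables and a copy of `elemVars`,
whose variables already occur in the first. -/
theorem isAdditive_witness (Dt : DatatypesSignature) :
    IsAdditive (DatatypesSignature.theory.{u} Dt) Dt.elemSorts (witness Dt) := by
  intro φ ψ _ hψ
  have he := extension_witness_and Dt φ ψ
  constructor
  · intro I _
    refine ⟨fun h => h.1, fun h => ⟨h, ?_⟩⟩
    rw [he]
    exact ⟨holds_elemVars _ _, (guard_of_termsAreVarsIn _ _ ψ hψ).1⟩
  · intro s _ n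
    refine ⟨fun h => ?_, Or.inl⟩
    rcases h with h | h
    · exact h
    -- Only the statement about variables is wanted; the one-point structure merely instantiates the
    -- lemma.
    · rw [he, QF.fv, (guard_of_termsAreVarsIn (Dt := Dt) (M := fun _ => PUnit.{u + 1})
        ⟨fun _ _ => ⟨⟩, fun _ _ => True⟩ (fun _ _ => ⟨⟩) ψ hψ).2, Set.union_empty] at h
      refine Or.inl (Or.inr ?_)
      rcases extension_cases Dt φ with ⟨χ, ψ, rfl⟩ | he
      · rw [extension_witness_and]
        exact Or.inl h
      · rw [he]
        exact Or.inl h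

end Guards

/-! ### Heights of trees -/

section Height

variable {Dt : DatatypesData} {D D' : Dt.Elem → Type u}

/-- The height of a tree. -/
def Tree.height {D : Dt.Elem → Type*} : {s : Dt.Elem ⊕ Dt.Struct} → Tree Dt D s → ℕ
  | _, .leaf _ => 0
  | _, .node _ args => Finset.univ.sup (fun i => (args i).height) + 1

theorem Tree.height_map {D : Dt.Elem → Type*} (g : ∀ e, D e → D' e) {s : Dt.Elem ⊕ Dt.Struct}
    (x : Tree Dt D s) : (x.map g).height = x.height := by
  induction x with
  | leaf a => rfl
  | node c args ih => simp [Tree.map, Tree.height, ih]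

theorem Tree.height_arg_lt {D : Dt.Elem → Type*} (c : Dt.Con)
    (args : (i : Fin (Dt.ar c)) → Tree Dt D (Dt.arg c i)) (i : Fin (Dt.ar c)) :
    (args i).height < (Tree.node c args).height := by
  rw [Tree.height, Nat.lt_succ_iff]
  exact Finset.le_sup (f := fun i => (args i).height) (Finset.mem_univ i)

/-- The height of a tree with arguments is attained at one of them. -/
theorem Tree.height_node {D : Dt.Elem → Type*} (c : Dt.Con)
    (args : (i : Fin (Dt.ar c)) → Tree Dt D (Dt.arg c i)) :
    (Tree.node c args).height = 1 ∨ ∃ i, (Tree.node c args).height = (args i).height + 1 := by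
  rw [Tree.height]
  rcases isEmpty_or_nonempty (Fin (Dt.ar c)) with h | h
  · left
    simp
  · right
    obtain ⟨i, -, hi⟩ := Finset.exists_mem_eq_sup Finset.univ Finset.univ_nonempty
      fun i => (args i).height
    exact ⟨i, by rw [hi]⟩

/-- All sorts are treated at once, since arguments of a node may have any sort. -/
theorem finite_setOf_height_le {D : Dt.Elem → Type*} [Finite Dt.Elem] [Finite Dt.Con]
    [∀ e, Finite (D e)] (n : ℕ) :
    {p : (s : Dt.Elem ⊕ Dt.Struct) × Tree Dt D s | p.2.height ≤ n}.Finite := by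
  have hleaf : (Set.range fun p : (e : Dt.Elem) × D e =>
      (⟨.inl p.1, .leaf p.2⟩ : (s : Dt.Elem ⊕ Dt.Struct) × Tree Dt D s)).Finite :=
    Set.finite_range _
  induction n with
  | zero =>
    refine hleaf.subset ?_
    rintro ⟨s, x⟩ hx
    cases x with
    | leaf a => exact ⟨⟨_, a⟩, rfl⟩
    | node c args => simp [Tree.height] at hx
  | succ n ih =>
    refine (hleaf.union (Set.finite_iUnion fun c : Dt.Con =>
      (Set.Finite.pi (t := fun i => {x : Tree Dt D (Dt.arg c i) | x.height ≤ n}) fun i =>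
        Set.Finite.preimage (f := Sigma.mk (Dt.arg c i)) sigma_mk_injective.injOn ih).image fun args =>
          (⟨.inr (Dt.res c), .node c args⟩ : (s : Dt.Elem ⊕ Dt.Struct) × Tree Dt D s))).subset ?_
    rintro ⟨s, x⟩ hx
    cases x with
    | leaf a => exact Or.inl ⟨⟨_, a⟩, rfl⟩
    | node c args =>
      refine Or.inr (Set.mem_iUnion.2 ⟨c, args, fun i _ => ?_, rfl⟩)
      exact Nat.lt_succ_iff.1 ((Tree.height_arg_lt c args i).trans_le hx)

/-- This is where inductivity enters: infinitely many trees over one-element sets cannot all have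
bounded height, and relabelling leaves preserves height. -/
theorem exists_height_ge (Dt : DatatypesSignature) (hind : ∀ s : Dt.Struct, Dt.IsInductiveSort s)
    {D : Dt.Elem → Type u} (hD : ∀ e, Nonempty (D e)) (s : Dt.Struct) (n : ℕ) :
    ∃ x : Tree Dt.toDatatypesData D (.inr s), n ≤ x.height := by
  have := Dt.finite_elem
  have := Dt.finite_con
  by_contra! hlt
  have hfin : (Set.univ : Set (Tree Dt.toDatatypesData (fun _ => Unit) (.inr s))).Finite := by
    refine ((finite_setOf_height_le (D := fun _ : Dt.Elem => Unit) n).preimage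
      (f := fun x => ⟨.inr s, x⟩) sigma_mk_injective.injOn).subset fun x _ => ?_
    have := hlt (x.map fun e _ => (hD e).some)
    rw [Tree.height_map] at this
    exact this.le
  exact (hind s).not_finite (Set.finite_univ_iff.1 hfin)

/-- There are trees `ρ s i` of sort `s`, for all numbers `i`, whose heights differ by more than `B`
for different `i`. -/
theorem exists_sparse_trees [Finite Dt.Struct]
    (hD : ∀ (s : Dt.Struct) (n : ℕ), ∃ x : Tree Dt D (.inr s), n ≤ x.height) (B : ℕ) :
    ∃ (H : ℕ → ℕ) (ρ : (s : Dt.Struct) → ℕ → Tree Dt D (.inr s)), B ≤ H 0 ∧ Monotone H ∧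
      ∀ s i, H i + B < (ρ s i).height ∧ (ρ s i).height ≤ H (i + 1) := by
  have := Fintype.ofFinite Dt.Struct
  choose pick hpick using hD
  -- `H (i + 1)` dominates the i-th trees of all sorts, while the trees with index i + 1 are chosen
  -- higher than `H (i + 1) + B`.
  let H : ℕ → ℕ := fun n => Nat.rec B
    (fun _ k => k + Finset.univ.sup fun s => (pick s (k + B + 1)).height) n
  refine ⟨H, fun s i => pick s (H i + B + 1), le_rfl, monotone_nat_of_le_succ fun n =>
    Nat.le_add_right _ _, fun s i => ⟨hpick s _, ?_⟩⟩
  exact (Finset.le_sup (f := fun s => (pick s (H i + B + 1)).height) (Finset.mem_univ s)).trans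
    (Nat.le_add_left _ _)

end Height

/-! ### Collapsing a model to finitely many elements -/

section Collapse

variable {Dt : DatatypesData} {D D' : Dt.Elem → Type u}

open Classical in
/-- Replace the elements of a tree by `g` and every subtree that is not tame by a tree of the
given family. -/
noncomputable def collapse (V : (s : Dt.Elem ⊕ Dt.Struct) → Set (Tree Dt D s))
    (g : ∀ e, D e → D' e) (idx : (s : Dt.Elem ⊕ Dt.Struct) × Tree Dt D s → ℕ)
    (ρ : (s : Dt.Struct) → ℕ → Tree Dt D' (.inr s)) :
    (s : Dt.Elem ⊕ Dt.Struct) → Tree Dt D s → Tree Dt D' s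
  | _, .leaf a => .leaf (g _ a)
  | _, .node c args =>
    if ∀ i, args i ∈ V _ then .node c fun i => collapse V g idx ρ _ (args i)
    else ρ _ (idx ⟨_, .node c args⟩)

variable {V : (s : Dt.Elem ⊕ Dt.Struct) → Set (Tree Dt D s)} {g : ∀ e, D e → D' e}
  {idx : (s : Dt.Elem ⊕ Dt.Struct) × Tree Dt D s → ℕ}
  {ρ : (s : Dt.Struct) → ℕ → Tree Dt D' (.inr s)}

theorem collapse_node {c : Dt.Con} {args : (i : Fin (Dt.ar c)) → Tree Dt D (Dt.arg c i)}
    (h : ∀ i, args i ∈ V _) :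
    collapse V g idx ρ _ (.node c args) = .node c fun i => collapse V g idx ρ _ (args i) := by
  rw [collapse, if_pos h]

theorem collapse_of_not_tame {s : Dt.Struct} {x : Tree Dt D (.inr s)} (h : ¬ Tame V x) :
    collapse V g idx ρ _ x = ρ s (idx ⟨_, x⟩) := by
  cases x with
  | node c args => exact (collapse.eq_2 V g idx ρ c args).trans (if_neg h)

/-- A tree either collapses to a tree that is not higher, or its collapse is a little higher than
that of some tree in `V` that is not tame. -/
theorem height_collapse {s : Dt.Elem ⊕ Dt.Struct} (x : Tree Dt D s) (hx : Tame V x) :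
    (collapse V g idx ρ _ x).height ≤ x.height ∨
      ∃ (s' : Dt.Struct) (w : Tree Dt D (.inr s')), w ∈ V _ ∧
        (ρ s' (idx ⟨_, w⟩)).height < (collapse V g idx ρ _ x).height ∧
        (collapse V g idx ρ _ x).height ≤ (ρ s' (idx ⟨_, w⟩)).height + x.height := by
  have wild : ∀ (s : Dt.Elem ⊕ Dt.Struct) (y : Tree Dt D s), y ∈ V _ → ¬ Tame V y →
      ∃ (s' : Dt.Struct) (w : Tree Dt D (.inr s')), w ∈ V _ ∧
        (collapse V g idx ρ _ y).height = (ρ s' (idx ⟨_, w⟩)).height := by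
    rintro (e | s) y hy hn
    · exact absurd (tame_of_elem hy) hn
    · exact ⟨s, y, hy, by rw [collapse_of_not_tame hn]⟩
  induction x with
  | leaf a => exact Or.inl le_rfl
  | node c args ih =>
    rw [collapse_node hx]
    rcases Tree.height_node c fun i => collapse V g idx ρ _ (args i) with h | ⟨i, h⟩
    · left
      rw [h, Tree.height]
      exact Nat.le_add_left _ _
    · rw [h]
      have hlt := Tree.height_arg_lt c args i
      by_cases hi : Tame V (args i)
      · rcases ih i hi with h | ⟨s', w, h₁, h₂, h₃⟩
        · left; omega
        · exact Or.inr ⟨s', w, h₁, by omega, by omega⟩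
      · obtain ⟨s', w, h₁, h₂⟩ := wild _ _ (hx i) hi
        exact Or.inr ⟨s', w, h₁, by omega, by omega⟩

/-- The collapse is injective on the trees that are tame or in `V`. -/
theorem collapse_injective {B : ℕ} {H : ℕ → ℕ} (hH₀ : B ≤ H 0) (hH : Monotone H)
    (hρ : ∀ s i, H i + B < (ρ s i).height ∧ (ρ s i).height ≤ H (i + 1))
    (hidx : Set.InjOn idx {p | p.2 ∈ V p.1})
    (hg : ∀ (e : Dt.Elem) (a b : D e), Tree.leaf a ∈ V _ → Tree.leaf b ∈ V _ →
      g e a = g e b → a = b)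
    (hB : ∀ (s : Dt.Elem ⊕ Dt.Struct) (x : Tree Dt D s), Tame V x → x.height ≤ B)
    {s : Dt.Elem ⊕ Dt.Struct} (x y : Tree Dt D s) (hx : Tame V x ∨ x ∈ V _)
    (hy : Tame V y ∨ y ∈ V _)
    (h : collapse V g idx ρ s x = collapse V g idx ρ s y) : x = y := by
  -- For i < j the j-th height exceeds `H j + B ≥ H (i + 1) + B`, hence the i-th by more than B,
  -- whatever the sorts.
  have gap : ∀ (s s' : Dt.Struct) (i j : ℕ), (ρ s i).height ≤ (ρ s' j).height →
      (ρ s' j).height ≤ (ρ s i).height + B → i = j := by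
    intro s s' i j h₁ h₂
    have h₃ := hρ s i
    have h₄ := hρ s' j
    rcases lt_trichotomy i j with hij | rfl | hij
    · have := hH (show i + 1 ≤ j from hij)
      omega
    · rfl
    · have := hH (show j + 1 ≤ i from hij)
      omega
  -- A collapsed tame tree has height at most B, below every replacement, or strictly exceeds some
  -- replacement by at most B. In the latter case `gap` forces that replacement to be the one for w,
  -- contradicting strictness.
  have mixed : ∀ (s : Dt.Struct) (w z : Tree Dt D (.inr s)), w ∈ V _ → ¬ Tame V w → Tame V z →
      collapse V g idx ρ _ w ≠ collapse V g idx ρ _ z := by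
    intro s w z hmem hn hz he
    rw [collapse_of_not_tame hn] at he
    have hzB := hB _ z hz
    have h₀ := (hρ s (idx ⟨_, w⟩)).1
    have h₁ : B ≤ H (idx ⟨_, w⟩) := hH₀.trans (hH (Nat.zero_le _))
    have he' := congrArg Tree.height he
    rcases height_collapse (g := g) (idx := idx) (ρ := ρ) z hz with h₂ | ⟨s', w', h₂, h₃, h₄⟩
    · omega
    · rw [← he'] at h₃ h₄
      have hi := gap _ _ _ _ h₃.le (h₄.trans (by omega))
      have hww := hidx (x₁ := ⟨_, w'⟩) (x₂ := ⟨_, w⟩) h₂ hmem hi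
      have hs : s' = s := by
        have := congrArg Sigma.fst hww
        exact Sum.inr_injective this
      subst hs
      rw [hi] at h₃
      exact lt_irrefl _ h₃
  -- Trees in V are included because the arguments of a tame node are only known to lie in V.
  induction x with
  | leaf a =>
    obtain ⟨b, rfl⟩ := y.exists_leaf
    rw [hg _ a b (or_self_iff.1 hx) (or_self_iff.1 hy) (Tree.leaf_injective h)]
  | node c args ih =>
    by_cases hxt : Tame V (Tree.node c args) <;> by_cases hyt : Tame V y
    · obtain ⟨args', rfl⟩ := y.root_eq_some_iff.1 (by
        rw [← root_eq_of_tame (h := collapse V g idx ρ) (fun c args => collapse_node) hyt, ← h,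
          root_eq_of_tame (h := collapse V g idx ρ) (fun c args => collapse_node) hxt]
        rfl)
      rw [collapse_node hxt, collapse_node hyt] at h
      congr 1
      funext i
      exact ih i _ (Or.inr (hxt i)) (Or.inr (hyt i)) (congrFun (Tree.node_injective h) i)
    · exact absurd h.symm (mixed _ _ _ (hy.resolve_left hyt) hyt hxt)
    · exact absurd h (mixed _ _ _ (hx.resolve_left hxt) hxt hyt)
    · rw [collapse_of_not_tame hxt, collapse_of_not_tame hyt] at h
      have hi := gap _ _ _ _ (congrArg Tree.height h).le (by rw [h]; exact Nat.le_add_right _ _)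
      have := hidx (x₁ := ⟨_, Tree.node c args⟩) (x₂ := ⟨_, y⟩) (hx.resolve_left hxt)
        (hy.resolve_left hyt) hi
      exact sigma_mk_injective this

/-- If `V` is finite, the tame trees have bounded height. -/
theorem exists_height_bound (hV : {p : (s : Dt.Elem ⊕ Dt.Struct) × Tree Dt D s |
    p.2 ∈ V p.1}.Finite) :
    ∃ B, ∀ (s : Dt.Elem ⊕ Dt.Struct) (x : Tree Dt D s), Tame V x → x.height ≤ B := by
  obtain ⟨B, hB⟩ := (hV.image fun p => p.2.height).bddAbove
  refine ⟨B + 1, fun s x hx => ?_⟩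
  cases x with
  | leaf a => exact Nat.zero_le _
  | node c args =>
    refine Nat.succ_le_succ (Finset.sup_le fun i _ => hB ⟨⟨_, args i⟩, hx i, rfl⟩)

end Collapse

/-- Every satisfiable witness has a finite model, even under additional conditions on the variables
of element sorts. -/
theorem finitelyWitnessed_witness_and (Dt : DatatypesSignature)
    (hind : ∀ s : Dt.Struct, Dt.IsInductiveSort s) (φ δ : QF Dt.sig)
    (hδ : δ.TermsAreVarsIn Dt.elemSorts) :
    FinitelyWitnessed (DatatypesSignature.theory.{u} Dt) Dt.elemSorts
      (.and (witness Dt φ) δ) := by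
  have := Dt.finite_struct
  rw [FinitelyWitnessed, or_iff_not_imp_left, not_not]
  rintro ⟨⟨A, v⟩, ⟨D, hD, O, hO, hA⟩, hφ, hδv⟩
  dsimp only at hA
  subst hA
  set F : Set (Var Dt.sig) := (QF.and (witness Dt φ) δ).fv
  have hfin : {p : (s : Dt.Elem ⊕ Dt.Struct) × Tree Dt.toDatatypesData D s |
      p.2 ∈ values F v p.1}.Finite := by
    refine ((QF.fv_finite (.and (witness Dt φ) δ)).image fun x =>
      (⟨x.1, v x.1 x.2⟩ : (s : Dt.Elem ⊕ Dt.Struct) × Tree Dt.toDatatypesData D s)).subset ?_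
    rintro ⟨s, x⟩ ⟨n, hn, hx⟩
    exact ⟨⟨s, n⟩, hn, congrArg (Sigma.mk s) hx⟩
  -- The purpose of `elemVars`: the shrunken element sets stay non-empty.
  have helem : ∀ e, (⟨.inl e, 0⟩ : Var Dt.sig) ∈ F := by
    intro e
    refine Or.inl (Or.inr ?_)
    rcases extension_cases Dt φ with ⟨χ, ψ, rfl⟩ | he
    · rw [extension_witness_and]
      exact Or.inl (mem_fv_elemVars.2 ⟨e, rfl⟩)
    · rw [he]
      exact Or.inl (mem_fv_elemVars.2 ⟨e, rfl⟩)
  let D' : Dt.Elem → Type u := fun e => {a : D e // Tree.leaf a ∈ values F v (.inl e)}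
  have hD' : ∀ e, Nonempty (D' e) := fun e => by
    obtain ⟨a, ha⟩ := (v (.inl e) 0).exists_leaf
    exact ⟨⟨a, 0, helem e, ha⟩⟩
  classical
  -- The default on other elements is harmless, since injectivity is only required on values of
  -- variables.
  let g : ∀ e, D e → D' e := fun e a =>
    if h : Tree.leaf a ∈ values F v (.inl e) then ⟨a, h⟩ else (hD' e).some
  have hg : ∀ (e : Dt.Elem) (a : D' e), g e a.1 = a := fun e a => dif_pos a.2
  obtain ⟨B, hB⟩ := exists_height_bound hfin
  obtain ⟨H, ρ, hH₀, hH, hρ⟩ := exists_sparse_trees (exists_height_ge Dt hind hD') B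
  obtain ⟨idx, hidx⟩ := Set.countable_iff_exists_injOn.1 hfin.countable
  have hT := isTransfer_transferOps (V := values F v) (h := collapse (values F v) g idx ρ)
    (Dt.tree_nonempty _ hD') hO (fun c args => collapse_node)
    (fun s x y hx hy => collapse_injective hH₀ hH hρ hidx
      (fun e a b ha hb hab => by
        have := (hg e ⟨a, ha⟩).symm.trans (hab.trans (hg e ⟨b, hb⟩))
        exact congrArg Subtype.val this) hB x y (Or.inl hx) (Or.inl hy))
  -- The guard of δ is trivially true and has no variables, so it yields tameness for δ with any
  -- base.
  have hδt := guard_of_termsAreVarsIn (Dt := Dt) (b := 0) O v δ hδ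
  refine ⟨⟨⟨_, Dt.tree_nonempty _ hD', _⟩, fun s n => collapse (values F v) g idx ρ s (v s n)⟩,
    ⟨_, hD', _, hT.target, rfl⟩, ⟨?_, ?_⟩, ?_⟩
  · exact hT.holds_witness φ hφ Set.subset_union_left
  · refine (hT.holds v δ (tame_of_holds_guard hO δ hδt.1 Set.subset_union_right ?_)).2 hδv
    rw [hδt.2]
    exact Set.empty_subset _
  · rintro s ⟨e, rfl⟩ x
    obtain ⟨a, rfl⟩ := Tree.exists_leaf x
    obtain ⟨n, hn, hv⟩ := a.2
    refine ⟨n, hn, ?_⟩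
    have : collapse (values F v) g idx ρ _ (v (.inl e) n) = Tree.leaf a := by
      rw [hv, collapse, hg]
    exact this

theorem isStrongWitness_witness (Dt : DatatypesSignature)
    (hind : ∀ s : Dt.Struct, Dt.IsInductiveSort s) :
    IsStrongWitness (DatatypesSignature.theory.{u} Dt) Dt.elemSorts (witness Dt) :=
  ⟨exEquivalent_witness Dt, fun φ _ hV δ hδ =>
    finitelyWitnessed_witness_and Dt hind φ δ (hδ.termsAreVarsIn hV)⟩

theorem isWitness_witness (Dt : DatatypesSignature)
    (hind : ∀ s : Dt.Struct, Dt.IsInductiveSort s) :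
    IsWitness (DatatypesSignature.theory.{u} Dt) Dt.elemSorts (witness Dt) := by
  refine ⟨exEquivalent_witness Dt, fun φ => ?_⟩
  rcases finitelyWitnessed_witness_and Dt hind φ .tru trivial with h | ⟨I, hI, hsat, hfin⟩
  · exact Or.inl fun ⟨I, hI, hsat⟩ => h ⟨I, hI, hsat, trivial⟩
  · refine Or.inr ⟨I, hI, hsat.1, fun s hs a => ?_⟩
    obtain ⟨n, hn, hv⟩ := hfin s hs a
    exact ⟨n, hn.resolve_right id, hv⟩

/-! ### Primitive recursive tools -/

section Primrec

variable {α β σ ι : Type} [Primcodable α] [Primcodable β] [Primcodable σ]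

/-- Course-of-values recursion. -/
theorem exists_primrec_strongRec {g : α → List σ → σ} (hg : Primrec₂ g) :
    ∃ f : α → ℕ → σ, Primrec₂ f ∧ ∀ a n, f a n = g a ((List.range n).map (f a)) := by
  let T : α → ℕ → List σ := fun a n => Nat.rec [] (fun _ l => l ++ [g a l]) n
  have hT : Primrec₂ T := by
    refine Primrec.nat_rec (f := fun _ : α => ([] : List σ)) (g := fun a p => p.2 ++ [g a p.2])
      (Primrec.const []) ?_
    have hl : Primrec fun p : α × ℕ × List σ => p.2.2 := Primrec.snd.comp Primrec.snd
    exact Primrec.list_append.comp hl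
      (Primrec.list_cons.comp (hg.comp Primrec.fst hl) (Primrec.const []))
  refine ⟨fun a n => g a (T a n), hg.comp Primrec.fst hT, fun a n => ?_⟩
  have hTn : ∀ n, T a n = (List.range n).map fun n => g a (T a n) := by
    intro n
    induction n with
    | zero => rfl
    | succ n ih => rw [List.range_succ, List.map_append, ← ih]; rfl
  exact congrArg (g a) (hTn n)

theorem primrec_pair {f g : α → ℕ} (hf : Primrec f) (hg : Primrec g) :
    Primrec fun x => Nat.pair (f x) (g x) :=
  Primrec₂.natPair.comp hf hg

theorem primrec_unpair_fst {f : α → ℕ} (hf : Primrec f) : Primrec fun x => (f x).unpair.1 :=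
  Primrec.fst.comp (Primrec.unpair.comp hf)

theorem primrec_unpair_snd {f : α → ℕ} (hf : Primrec f) : Primrec fun x => (f x).unpair.2 :=
  Primrec.snd.comp (Primrec.unpair.comp hf)

theorem primrec_lookup {l : α → List ℕ} {f : α → ℕ} (hl : Primrec l) (hf : Primrec f) :
    Primrec fun x => (l x).getD (f x) 0 :=
  (Primrec.list_getD 0).comp hl hf

theorem primrec_map_const (L : List ι) {F : ι → β → σ} (hF : ∀ i, Primrec (F i)) :
    Primrec fun x => L.map fun i => F i x := by
  induction L with
  | nil => exact Primrec.const []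
  | cons i L ih => exact Primrec.list_cons.comp (hF i) ih

/-- Apply the function with the given number. -/
noncomputable def dispatch (h : Finite ι) (F : ι → β → ℕ) (k : ℕ) (x : β) : ℕ :=
  ((enum h).map fun i => F i x).getD k 0

theorem dispatch_num {ι β : Type} (h : Finite ι) (F : ι → β → ℕ) (i : ι) (x : β) :
    dispatch h F (num h i) x = F i x := by
  simp [dispatch, enum, num]

theorem primrec_dispatch (h : Finite ι) {F : ι → β → ℕ} (hF : ∀ i, Primrec (F i)) {k : α → ℕ}
    {x : α → β} (hk : Primrec k) (hx : Primrec x) : Primrec fun a => dispatch h F (k a) (x a) :=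
  primrec_lookup ((primrec_map_const (enum h) hF).comp hx) hk

/-- The list with the given code. -/
def listOfCode (n : ℕ) : List ℕ := (Encodable.decode (α := List ℕ) n).getD []

theorem listOfCode_encode (l : List ℕ) : listOfCode (Encodable.encode l) = l := by
  simp [listOfCode]

theorem primrec_listOfCode {f : α → ℕ} (hf : Primrec f) : Primrec fun x => listOfCode (f x) :=
  Primrec.option_getD.comp (Primrec.decode.comp hf) (Primrec.const [])

/-- The code of a conjunction of formulas from the list of their codes. -/
def bigAndCode (l : List ℕ) : ℕ :=
  l.foldr (fun c r => Nat.pair 5 (Nat.pair c r)) (Nat.pair 2 0)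

/-- The code of a disjunction of formulas from the list of their codes. -/
def bigOrCode (l : List ℕ) : ℕ :=
  l.foldr (fun c r => Nat.pair 6 (Nat.pair c r)) (Nat.pair 3 0)

theorem primrec_fold {l : α → List ℕ} (hl : Primrec l) (a b : ℕ) :
    Primrec fun x => (l x).foldr (fun c r => Nat.pair a (Nat.pair c r)) b := by
  refine Primrec.list_foldr (h := fun _ p => Nat.pair a (Nat.pair p.1 p.2)) hl (Primrec.const b) ?_
  exact primrec_pair (Primrec.const a)
    (primrec_pair (Primrec.fst.comp Primrec.snd) (Primrec.snd.comp Primrec.snd))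

theorem primrec_bigAndCode {l : α → List ℕ} (hl : Primrec l) : Primrec fun x => bigAndCode (l x) :=
  primrec_fold hl _ _

theorem primrec_bigOrCode {l : α → List ℕ} (hl : Primrec l) : Primrec fun x => bigOrCode (l x) :=
  primrec_fold hl _ _

theorem QF.code_bigAnd {Sg : Signature} [Sg.IsFinite] (l : List (QF Sg)) :
    (QF.bigAnd l).code = bigAndCode (l.map QF.code) := by
  induction l with
  | nil => rfl
  | cons φ l ih =>
    show (QF.and φ (QF.bigAnd l)).code = _
    rw [QF.code, ih]
    rfl

theorem QF.code_bigOr {Sg : Signature} [Sg.IsFinite] (l : List (QF Sg)) :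
    (QF.bigOr l).code = bigOrCode (l.map QF.code) := by
  induction l with
  | nil => rfl
  | cons φ l ih =>
    show (QF.or φ (QF.bigOr l)).code = _
    rw [QF.code, ih]
    rfl

theorem getD_map_range (f : ℕ → ℕ) {m n : ℕ} (h : m < n) :
    ((List.range n).map f).getD m 0 = f m := by
  simp [h]

end Primrec

/-! ### Computability of the witness -/

section GuardCodes

variable (Dt : DatatypesSignature)

open Classical in
/-- The code of `builtByOf b s t c` from `b` and the code of `t`. -/
noncomputable def builtByCode (s : Dt.Struct) (c : Dt.Con) (x : ℕ × ℕ) : ℕ :=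
  if s = Dt.res c then
    Nat.pair 0 (Nat.pair (num Dt.sig_isFinite.srt (.inr (Dt.res c))) (Nat.pair x.2
      (Nat.pair 1 (Nat.pair (num Dt.sig_isFinite.func (.con c))
        (Encodable.encode (List.ofFn fun i : Fin (Dt.ar c) =>
          Nat.pair 0 (Nat.pair (num Dt.sig_isFinite.srt (Dt.arg c i)) (Nat.pair x.1
            (Nat.pair 1 (Nat.pair (num Dt.sig_isFinite.func (.sel c i))
              (Encodable.encode [x.2])))))))))))
  else Nat.pair 3 0

/-- The code of `caseSplit b s t` from `b` and the code of `t`. -/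
noncomputable def caseSplitCode (s : Dt.Struct) (x : ℕ × ℕ) : ℕ :=
  bigOrCode ((enum Dt.finite_con).map fun c => builtByCode Dt s c x)

/-- The code of the guard of a variable from its base and the code of the variable. -/
noncomputable def varGuardCode : Dt.sig.Srt → ℕ × ℕ → ℕ
  | .inl _, _ => Nat.pair 2 0
  | .inr s, x => caseSplitCode Dt s x

/-- The code of `appGuard b s t` from `b` and the code of `t`. -/
noncomputable def appGuardCode : Dt.sig.Srt → ℕ × ℕ → ℕ
  | .inl e, x => Nat.pair 0 (Nat.pair (num Dt.sig_isFinite.srt (.inl e)) (Nat.pair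
      (Nat.pair 0 (Nat.pair (num Dt.sig_isFinite.srt (.inl e)) (Nat.pair x.1 x.2))) x.2))
  | .inr s, x => caseSplitCode Dt s x

variable {Dt}

theorem primrec_caseSplitCode (s : Dt.Struct) : Primrec (caseSplitCode Dt s) := by
  refine primrec_bigOrCode (primrec_map_const _ fun c => ?_)
  unfold builtByCode
  split_ifs
  · refine primrec_pair (Primrec.const _) (primrec_pair (Primrec.const _)
      (primrec_pair Primrec.snd (primrec_pair (Primrec.const _) (primrec_pair (Primrec.const _)
        (Primrec.encode.comp (Primrec.list_ofFn fun i => ?_))))))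
    exact primrec_pair (Primrec.const _) (primrec_pair (Primrec.const _)
      (primrec_pair Primrec.fst (primrec_pair (Primrec.const _) (primrec_pair (Primrec.const _)
        (Primrec.encode.comp (Primrec.list_cons.comp Primrec.snd (Primrec.const [])))))))
  · exact Primrec.const _

theorem primrec_varGuardCode (s : Dt.sig.Srt) : Primrec (varGuardCode Dt s) := by
  rcases s with e | s
  · exact Primrec.const _
  · exact primrec_caseSplitCode s

theorem primrec_appGuardCode (s : Dt.sig.Srt) : Primrec (appGuardCode Dt s) := by
  rcases s with e | s
  · exact primrec_pair (Primrec.const _) (primrec_pair (Primrec.const _) (primrec_pair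
      (primrec_pair (Primrec.const _) (primrec_pair (Primrec.const _)
        (primrec_pair Primrec.fst Primrec.snd))) Primrec.snd))
  · exact primrec_caseSplitCode s

theorem code_caseSplit (b : ℕ) (s : Dt.Struct) (t : Term Dt.sig (.inr s)) :
    (caseSplit Dt b s t).code = caseSplitCode Dt s (b, t.code) := by
  rw [caseSplit, QF.code_bigOr, List.map_map, caseSplitCode]
  congr 2
  funext c
  simp only [Function.comp_apply, builtByOf, builtByCode]
  split_ifs with h
  · subst h
    rfl
  · rfl

theorem code_varGuard (b : ℕ) (s : Dt.sig.Srt) (n : ℕ) :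
    (varGuard Dt b s n).code = varGuardCode Dt s (b, (Term.var (Sg := Dt.sig) s n).code) := by
  rcases s with e | s
  · rfl
  · exact code_caseSplit b s _

theorem code_appGuard (b : ℕ) (s : Dt.sig.Srt) (t : Term Dt.sig s) :
    (appGuard Dt b s t).code = appGuardCode Dt s (b, t.code) := by
  rcases s with e | s
  · rfl
  · exact code_caseSplit b s _

theorem exists_primrec_termGuard (Dt : DatatypesSignature) : ∃ f : ℕ → ℕ → ℕ, Primrec₂ f ∧
    ∀ (b : ℕ) (s : Dt.sig.Srt) (t : Term Dt.sig s), (termGuard Dt b t).code = f b t.code := by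
  -- The list holds the values at all smaller codes, so its length is the current code. Tag 0 marks
  -- a variable, otherwise the code is that of an application; the lookup default 0 is never reached
  -- on codes of terms.
  let g : ℕ → List ℕ → ℕ := fun b l =>
    if l.length.unpair.1 = 0 then
      dispatch Dt.sig_isFinite.srt (varGuardCode Dt) l.length.unpair.2.unpair.1 (b, l.length)
    else Nat.pair 5 (Nat.pair
      (bigAndCode ((listOfCode l.length.unpair.2.unpair.2).map fun m => l.getD m 0))
      (dispatch Dt.sig_isFinite.func (fun f => appGuardCode Dt (Dt.sig.res f))
        l.length.unpair.2.unpair.1 (b, l.length)))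
  have hg : Primrec₂ g := by
    have hn : Primrec fun p : ℕ × List ℕ => p.2.length := Primrec.list_length.comp Primrec.snd
    have hx : Primrec fun p : ℕ × List ℕ => (p.1, p.2.length) := Primrec.fst.pair hn
    refine Primrec.ite (Primrec.eq.comp (primrec_unpair_fst hn) (Primrec.const 0))
      (primrec_dispatch _ primrec_varGuardCode
        (primrec_unpair_fst (primrec_unpair_snd hn)) hx)
      (primrec_pair (Primrec.const _) (primrec_pair (primrec_bigAndCode (Primrec.list_map
        (primrec_listOfCode (primrec_unpair_snd (primrec_unpair_snd hn)))
        (primrec_lookup (Primrec.snd.comp Primrec.fst) Primrec.snd)))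
        (primrec_dispatch _ (fun f => primrec_appGuardCode _)
          (primrec_unpair_fst (primrec_unpair_snd hn)) hx)))
  obtain ⟨f, hf, hfg⟩ := exists_primrec_strongRec hg
  refine ⟨f, hf, fun b s t => ?_⟩
  induction t with
  | var s n =>
    rw [hfg]
    simp only [g, List.length_map, List.length_range]
    rw [termGuard, code_varGuard, Term.code]
    simp only [Nat.unpair_pair, if_true]
    rw [dispatch_num]
  | app F args ih =>
    rw [hfg]
    simp only [g, List.length_map, List.length_range]
    rw [termGuard, QF.code, QF.code_bigAnd, code_appGuard]
    have hlt := Term.code_arg_lt F args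
    rw [Term.code] at hlt ⊢
    simp only [Nat.unpair_pair, one_ne_zero, if_false, listOfCode_encode]
    rw [dispatch_num, List.map_ofFn, List.map_ofFn]
    congr 4
    funext i
    simp only [Function.comp_apply]
    rw [getD_map_range _ (hlt i), ih]

theorem exists_primrec_guard (Dt : DatatypesSignature) : ∃ f : ℕ → ℕ → ℕ, Primrec₂ f ∧
    ∀ (b : ℕ) (φ : QF Dt.sig), (guard Dt b φ).code = f b φ.code := by
  obtain ⟨T, hT, hTg⟩ := exists_primrec_termGuard Dt
  -- Tags: 0 equation, 1 predicate, 2 and 3 constants, 4 negation, 5 and 6 conjunction and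
  -- disjunction, whose guards are both conjunctions.
  let g : ℕ → List ℕ → ℕ := fun b l =>
    if l.length.unpair.1 = 0 then
      Nat.pair 5 (Nat.pair (T b l.length.unpair.2.unpair.2.unpair.1)
        (T b l.length.unpair.2.unpair.2.unpair.2))
    else if l.length.unpair.1 = 1 then
      bigAndCode ((listOfCode l.length.unpair.2.unpair.2).map (T b))
    else if l.length.unpair.1 < 4 then Nat.pair 2 0
    else if l.length.unpair.1 = 4 then l.getD l.length.unpair.2 0
    else Nat.pair 5 (Nat.pair (l.getD l.length.unpair.2.unpair.1 0)
      (l.getD l.length.unpair.2.unpair.2 0))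
  have hg : Primrec₂ g := by
    have hn : Primrec fun p : ℕ × List ℕ => p.2.length := Primrec.list_length.comp Primrec.snd
    have h₁ := primrec_unpair_fst hn
    have h₂ := primrec_unpair_snd hn
    have h₂₁ := primrec_unpair_fst h₂
    have h₂₂ := primrec_unpair_snd h₂
    refine Primrec.ite (Primrec.eq.comp h₁ (Primrec.const 0)) ?_
      (Primrec.ite (Primrec.eq.comp h₁ (Primrec.const 1)) ?_
      (Primrec.ite (Primrec.nat_lt.comp h₁ (Primrec.const 4)) (Primrec.const _)
      (Primrec.ite (Primrec.eq.comp h₁ (Primrec.const 4)) ?_ ?_)))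
    · exact primrec_pair (Primrec.const _) (primrec_pair
        (hT.comp Primrec.fst (primrec_unpair_fst h₂₂))
        (hT.comp Primrec.fst (primrec_unpair_snd h₂₂)))
    · exact primrec_bigAndCode (Primrec.list_map (primrec_listOfCode h₂₂)
        (hT.comp (Primrec.fst.comp Primrec.fst) Primrec.snd))
    · exact primrec_lookup Primrec.snd h₂
    · exact primrec_pair (Primrec.const _) (primrec_pair (primrec_lookup Primrec.snd h₂₁)
        (primrec_lookup Primrec.snd h₂₂))
  obtain ⟨f, hf, hfg⟩ := exists_primrec_strongRec hg
  have lt_and : ∀ k {m n r : ℕ}, 0 < k → m = n ∨ m = r → m < Nat.pair k (Nat.pair n r) := by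
    rintro k m n r hk (rfl | rfl)
    · exact (Nat.left_le_pair _ _).trans_lt (lt_pair_of_pos hk _)
    · exact (Nat.right_le_pair _ _).trans_lt (lt_pair_of_pos hk _)
  refine ⟨f, hf, fun b φ => ?_⟩
  induction φ with
  | eq t t' => rw [hfg]; simp [g, guard, QF.code, hTg]
  | pred P args =>
    rw [hfg]
    simp only [g, List.length_map, List.length_range]
    rw [guard, QF.code, QF.code_bigAnd]
    simp only [Nat.unpair_pair, one_ne_zero, if_false, if_true, listOfCode_encode]
    rw [List.map_ofFn, List.map_ofFn]
    congr 2
    funext i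
    exact hTg b _ _
  | tru => rw [hfg]; simp [g, guard, QF.code]
  | fls => rw [hfg]; simp [g, guard, QF.code]
  | neg φ ih =>
    rw [hfg]
    simp only [g, List.length_map, List.length_range]
    rw [guard, QF.code, Nat.unpair_pair]
    simp only [OfNat.ofNat_ne_zero, OfNat.ofNat_ne_one, lt_irrefl, if_false, if_true]
    rw [getD_map_range _ (lt_pair_of_pos (by norm_num) _), ih]
  | and φ ψ ih₁ ih₂ =>
    rw [hfg]
    simp only [g, List.length_map, List.length_range]
    rw [guard, QF.code, QF.code, Nat.unpair_pair]
    simp only [Nat.unpair_pair]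
    rw [getD_map_range _ (lt_and 5 (by norm_num) (.inl rfl)),
      getD_map_range _ (lt_and 5 (by norm_num) (.inr rfl)), ih₁, ih₂]
    rfl
  | or φ ψ ih₁ ih₂ =>
    rw [hfg]
    simp only [g, List.length_map, List.length_range]
    rw [guard, QF.code, QF.code, Nat.unpair_pair]
    simp only [Nat.unpair_pair]
    rw [getD_map_range _ (lt_and 6 (by norm_num) (.inl rfl)),
      getD_map_range _ (lt_and 6 (by norm_num) (.inr rfl)), ih₁, ih₂]
    rfl

theorem exists_primrec_extension (Dt : DatatypesSignature) : ∃ f : ℕ → ℕ, Primrec f ∧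
    ∀ φ : QF Dt.sig, (extension Dt φ).code = f φ.code := by
  obtain ⟨G, hG, hGg⟩ := exists_primrec_guard Dt
  -- The test ρ = `extension` χ becomes a comparison of the code of ρ with the earlier value at the
  -- code of χ; injectivity of codes makes it exact.
  let g : Unit → List ℕ → ℕ := fun _ l =>
    Nat.pair 5 (Nat.pair (elemVars Dt).code (G (l.length + 1)
      (if l.length.unpair.1 = 5 ∧ l.length.unpair.2.unpair.1.unpair.1 = 5 ∧
          l.length.unpair.2.unpair.1.unpair.2.unpair.2 =
            l.getD l.length.unpair.2.unpair.1.unpair.2.unpair.1 0 then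
        l.length.unpair.2.unpair.2
      else l.length)))
  have hg : Primrec₂ g := by
    have hn : Primrec fun p : Unit × List ℕ => p.2.length := Primrec.list_length.comp Primrec.snd
    have h₂ := primrec_unpair_snd hn
    have h₂₁ := primrec_unpair_fst h₂
    have h₂₁₂ := primrec_unpair_snd h₂₁
    refine primrec_pair (Primrec.const _) (primrec_pair (Primrec.const _)
      (hG.comp (Primrec.succ.comp hn) (Primrec.ite ?_ (primrec_unpair_snd h₂) hn)))
    exact (Primrec.eq.comp (primrec_unpair_fst hn) (Primrec.const 5)).and
      ((Primrec.eq.comp (primrec_unpair_fst h₂₁) (Primrec.const 5)).and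
      (Primrec.eq.comp (primrec_unpair_snd h₂₁₂)
        (primrec_lookup Primrec.snd (primrec_unpair_fst h₂₁₂))))
  obtain ⟨f, hf, hfg⟩ := exists_primrec_strongRec hg
  refine ⟨f (), hf.comp (Primrec.const ()) Primrec.id, fun φ => ?_⟩
  induction hm : φ.code using Nat.strong_induction_on generalizing φ with
  | _ m ih =>
    subst hm
    rw [hfg]
    simp only [g, List.length_map, List.length_range]
    have generic : ∀ q : Prop, [Decidable q] → ¬ q →
        extension Dt φ = .and (elemVars Dt) (guard Dt (φ.code + 1) φ) → (extension Dt φ).code =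
          Nat.pair 5 (Nat.pair (elemVars Dt).code (G (φ.code + 1)
            (if q then φ.code.unpair.2.unpair.2 else φ.code))) := by
      intro q _ hq he
      rw [he, if_neg hq, QF.code, hGg]
    by_cases h₁ : ∃ φ₁ ψ, φ = .and φ₁ ψ
    · obtain ⟨φ₁, ψ, rfl⟩ := h₁
      by_cases h₂ : ∃ χ ρ, φ₁ = .and χ ρ
      · obtain ⟨χ, ρ, rfl⟩ := h₂
        have hlt : χ.code < (QF.and (.and χ ρ) ψ).code :=
          (QF.code_left_lt _ _).trans (QF.code_left_lt _ _)
        have hih := ih _ hlt χ rfl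
        by_cases hρ : ρ = extension Dt χ
        · rw [if_pos, extension, if_pos hρ, QF.code, hGg]
          · simp only [QF.code, Nat.unpair_pair]
          · have hu : (QF.and (.and χ ρ) ψ).code.unpair.2.unpair.1.unpair.2.unpair.1 = χ.code := by
              simp only [QF.code, Nat.unpair_pair]
            rw [hu, getD_map_range _ hlt, ← hih, ← hρ]
            simp only [QF.code, Nat.unpair_pair, and_self]
        · refine generic _ ?_ (by rw [extension, if_neg hρ])
          rintro ⟨-, -, h⟩
          have hu : (QF.and (.and χ ρ) ψ).code.unpair.2.unpair.1.unpair.2.unpair.1 = χ.code := by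
            simp only [QF.code, Nat.unpair_pair]
          rw [hu, getD_map_range _ hlt, ← hih] at h
          refine hρ (QF.code_injective (Eq.trans ?_ h))
          simp only [QF.code, Nat.unpair_pair]
      · refine generic _ ?_ ?_
        · rintro ⟨-, h, -⟩
          cases φ₁ <;> simp [QF.code] at h
          exact h₂ ⟨_, _, rfl⟩
        · cases φ₁ <;> try rfl
          exact absurd ⟨_, _, rfl⟩ h₂
    · refine generic _ ?_ ?_
      · rintro ⟨h, -, -⟩
        cases φ <;> simp [QF.code] at h
        exact h₁ ⟨_, _, rfl⟩
      · cases φ <;> try rfl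
        exact absurd ⟨_, _, rfl⟩ h₁

theorem isComputable_witness (Dt : DatatypesSignature) : IsComputable (witness Dt) := by
  obtain ⟨f, hf, hfe⟩ := exists_primrec_extension Dt
  refine ⟨fun n => Part.some (Nat.pair 5 (Nat.pair n (f n))), ?_, fun φ => ?_⟩
  · exact Nat.Partrec.of_primrec (Primrec.nat_iff.1
      (primrec_pair (Primrec.const 5) (primrec_pair Primrec.id hf)))
  · rw [witness, QF.code, hfe]
    exact Part.mem_some _

end GuardCodes

end Polite

/-- If all struct sorts of a datatypes signature are inductive, then its theory of datatypes is
strongly polite (and, moreover, additively polite) with respect to the set of element sorts. -/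
theorem theorem2 (Dt : Polite.DatatypesSignature)
    (hind : ∀ s : Dt.Struct, Dt.IsInductiveSort s) :
    Polite.StronglyPolite (Polite.DatatypesSignature.theory.{u} Dt) Dt.elemSorts ∧
      Polite.AdditivelyPolite (Polite.DatatypesSignature.theory.{u} Dt) Dt.elemSorts :=
  ⟨⟨Dt.smooth, Polite.witness Dt, Polite.isComputable_witness Dt,
      Polite.isStrongWitness_witness Dt hind⟩,
    ⟨Dt.smooth, Polite.witness Dt, Polite.isComputable_witness Dt,
      Polite.isWitness_witness Dt hind, Polite.isAdditive_witness Dt⟩⟩
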